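/- Three masses $m_1,m_2,m_3>0$ move on the unit sphere $\mathbb S^2\subset\mathbb R^3$ under the cotangent potential, i.e. with Lagrangian $\sum_i \frac{m_i}{2}|\dot q_i|^2+\sum_{i<j} m_im_j\cot\sigma_{ij}$, where $\sigma_{ij}\in(0,\pi)$ is the angle between $q_i$ and $q_j$. Write $\sigma_k=\sigma_{ij}$ for $\{i,j,k\}=\{1,2,3\}$; the point $(\sigma_1,\sigma_2,\sigma_3)\in U=(0,\pi)^3$ is the shape of the configuration. A relative equilibrium (RE) is a configuration whose uniform rotation about the $z$-axis, with some constant angular velocity, solves the equations of motion. It is a Lagrange relative equilibrium (LRE) if the three masses are not on a common great circle, and an Euler relative equilibrium (ERE) on a rotating meridian if they are on a common great circle through the rotation axis. A point $p\in U$ on the plane $\sigma_3=\sigma_1+\sigma_2$ is called a bifurcation point between ERE on a rotating meridian and LRE, for given masses, if (for these masses) (a) there is a regular $C^1$ curve $\gamma:(-\varepsilon,\varepsilon)\to U$ in that plane with $\gamma(0)=p$ such that every $\gamma(t)$ is the shape of an ERE on a rotating meridian; and (b) two continuations of LRE with opposite orientations are connected at an ERE of shape $p$: there are a regular $C^1$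 curve $\gamma:(-\varepsilon,\varepsilon)\to\mathbb R^3$ with $\gamma(0)=p$ and a continuous family $Q(t)$, $|t|<\varepsilon$, of configurations, where $Q(t)$ has shape $\gamma(|t|)$, such that $Q(0)$ is an ERE on a rotating meridian, $Q(t)$ is a positively oriented LRE for $t>0$, and $Q(t)$ is a negatively oriented LRE for $t<0$. Let $$h=\cos(3\sigma_3)-3\cos\sigma_3+2\cos(2\sigma_3)\cos(\sigma_1-\sigma_2).$$ **Theorem.** (1) Let $p=(\sigma_1,\sigma_2,\sigma_3)\in U$ satisfy $\sigma_3=\sigma_1+\sigma_2$ and $h(p)=0$. Then $p$ is a bifurcation point between ERE on a rotating meridian and LRE for a continuum of positive mass ratios $(\nu_1,\nu_2)=(m_1/m_3,\,m_2/m_3)$; precisely, there is a nondegenerate line segment in $\{\nu_1>0,\ \nu_2>0\}$ such that $p$ is a bifurcation point for all masses whose ratios $(\nu_1,\nu_2)$ lie on that segment. (2) Conversely, let $m_1,m_2,m_3>0$ be fixed and suppose that a continuation of LRE for these masses reaches a point $p\in U$ of the plane $\sigma_3=\sigma_1+\sigma_2$, i.e. there is a continuous curve $\gamma:[0,1]\to\mathbb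 R^3$ with $\gamma(0)=p$ such that $\gamma(t)$ is the shape of an LRE for every $0<t\le1$. Then $h(p)=0$, and $p$ is a bifurcation point between ERE on a rotating meridian and LRE for these masses. -/

import Mathlib

open Set

noncomputable section

namespace CurvedThreeBody

/-- The ambient Euclidean space of the unit sphere. -/
abbrev E3 := EuclideanSpace ℝ (Fin 3)

/-- A configuration: the positions of the three masses. The masses `m₁, m₂, m₃` have the
indices `0, 1, 2`. -/
abbrev Config := Fin 3 → E3

/-- A point `(σ₁, σ₂, σ₃)` of the shape space, with indices `0, 1, 2`. -/
abbrev Shape := Fin 3 → ℝ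

/-- The rotation axis. -/
def axis : E3 := !₂[0, 0, 1]

/-- Rotation by the angle `a` about the `z`-axis. -/
def rotZ (a : ℝ) (v : E3) : E3 :=
  !₂[Real.cos a * v 0 - Real.sin a * v 1, Real.sin a * v 0 + Real.cos a * v 1, v 2]

/-- The motion `q` solves the positively curved three-body problem with masses `m` on the unit
sphere, without collisions or antipodal pairs. The equations are the Euler-Lagrange equations,
on the sphere, of the Lagrangian
`∑ i, m i / 2 * ‖q i'‖ ^ 2 + ∑ i < j, m i * m j * cos σ_ij / sqrt (1 - cos σ_ij ^ 2)`,
where `cos σ_ij = ⟪q i, q j⟫`: the force is the tangential gradient of the second sum and the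
last term is the constraint force that keeps the mass on the sphere. -/
def IsSolution (m : Fin 3 → ℝ) (q : Fin 3 → ℝ → E3) : Prop :=
  (∀ i t, ‖q i t‖ = 1) ∧
  (∀ i j t, i ≠ j → (inner ℝ (q i t) (q j t)) ^ 2 ≠ 1) ∧
  (∀ i, ContDiff ℝ 2 (q i)) ∧
  ∀ i t, m i • deriv (deriv (q i)) t =
    (∑ j ∈ Finset.univ.erase i,
      (m i * m j / (√(1 - (inner ℝ (q i t) (q j t)) ^ 2)) ^ 3) •
        (q j t - (inner ℝ (q i t) (q j t)) • q i t))
    - (m i * ‖deriv (q i) t‖ ^ 2) • q i t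

/-- `Q` is the configuration at time `0` of a relative equilibrium: for some angular velocity
`ω`, the uniform rotation of `Q` about the `z`-axis (`θ_k' = 0`, `φ_k' = ω`) is a solution. -/
def IsRE (m : Fin 3 → ℝ) (Q : Config) : Prop :=
  ∃ ω : ℝ, IsSolution m (fun i t => rotZ (ω * t) (Q i))

/-- The three masses lie on a common geodesic (great circle). -/
def OnGeodesic (Q : Config) : Prop :=
  ∃ n : E3, n ≠ 0 ∧ ∀ i, inner ℝ n (Q i) = 0

/-- The three masses lie on a common meridian, i.e. a great circle through the rotation axis. -/
def OnMeridian (Q : Config) : Prop :=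
  ∃ n : E3, n ≠ 0 ∧ inner ℝ n axis = 0 ∧ ∀ i, inner ℝ n (Q i) = 0

/-- Euler relative equilibrium on a rotating meridian. -/
def IsMeridianERE (m : Fin 3 → ℝ) (Q : Config) : Prop := IsRE m Q ∧ OnMeridian Q

/-- Lagrange relative equilibrium: the masses are not on a common geodesic. -/
def IsLRE (m : Fin 3 → ℝ) (Q : Config) : Prop := IsRE m Q ∧ ¬ OnGeodesic Q

/-- The shape of a configuration: `σ_k` is the angle between the other two masses. -/
def shape (Q : Config) : Shape :=
  fun k => InnerProductGeometry.angle (Q (k + 1)) (Q (k + 2))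

/-- The sign of this determinant is the orientation of the triangle. -/
def orientation (Q : Config) : ℝ := Matrix.det (Matrix.of fun i j => Q i j)

/-- The domain `0 < σ_k < π` of the shape space. -/
def U : Set Shape := {σ | ∀ k, 0 < σ k ∧ σ k < Real.pi}

/-- The plane `σ₃ = σ₁ + σ₂`. -/
def eulerPlane : Set Shape := {σ | σ 2 = σ 0 + σ 1}

/-- The shapes of the Lagrange relative equilibria with masses `m`. -/
def lreShapes (m : Fin 3 → ℝ) : Set Shape := {σ | ∃ Q, IsLRE m Q ∧ shape Q = σ}

/-- The shapes of the Euler relative equilibria on a rotating meridian with masses `m`. -/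
def ereShapes (m : Fin 3 → ℝ) : Set Shape := {σ | ∃ Q, IsMeridianERE m Q ∧ shape Q = σ}

/-- The function `h` that defines the curve on the plane `σ₃ = σ₁ + σ₂`. -/
def h (σ : Shape) : ℝ :=
  Real.cos (3 * σ 2) - 3 * Real.cos (σ 2) + 2 * Real.cos (2 * σ 2) * Real.cos (σ 0 - σ 1)

/-- `γ`, restricted to `(-ε, ε)`, is a regular `C¹` curve through `p`. -/
def IsRegularArc (p : Shape) (ε : ℝ) (γ : ℝ → Shape) : Prop :=
  0 < ε ∧ γ 0 = p ∧ ContDiffOn ℝ 1 γ (Ioo (-ε) ε) ∧ ∀ t ∈ Ioo (-ε) ε, deriv γ t ≠ 0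

/-- For the masses `m`, Euler relative equilibria on a rotating meridian with `σ₃ = σ₁ + σ₂` can
be continued through the shape `p`. -/
def HasEREContinuation (m : Fin 3 → ℝ) (p : Shape) : Prop :=
  ∃ (ε : ℝ) (γ : ℝ → Shape), IsRegularArc p ε γ ∧
    ∀ t ∈ Ioo (-ε) ε, γ t ∈ ereShapes m ∩ eulerPlane

/-- For the masses `m`, two continuations of Lagrange relative equilibria with opposite
orientations are connected at an Euler relative equilibrium of shape `p` on a rotating meridian.
The half `t > 0` of the regular arc `γ` consists of the shapes of these Lagrange relative
equilibria; the continuous family `Q` of configurations runs through them with negative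
orientation for `t < 0` and with positive orientation for `t > 0`. -/
def HasLRECoupling (m : Fin 3 → ℝ) (p : Shape) : Prop :=
  ∃ (ε : ℝ) (γ : ℝ → Shape) (Q : ℝ → Config), IsRegularArc p ε γ ∧
    ContinuousOn Q (Ioo (-ε) ε) ∧
    (∀ t ∈ Ioo (-ε) ε, shape (Q t) = γ |t|) ∧
    IsMeridianERE m (Q 0) ∧
    (∀ t ∈ Ioo (-ε) 0, IsLRE m (Q t) ∧ orientation (Q t) < 0) ∧
    (∀ t ∈ Ioo 0 ε, IsLRE m (Q t) ∧ 0 < orientation (Q t))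

/-- For the masses `m`, the point `p` of the plane `σ₃ = σ₁ + σ₂` is a bifurcation point of
Lagrange relative equilibria and Euler relative equilibria on a rotating meridian. -/
def IsBifurcationPoint (m : Fin 3 → ℝ) (p : Shape) : Prop :=
  p ∈ U ∩ eulerPlane ∧ HasEREContinuation m p ∧ HasLRECoupling m p

/-- For the masses `m`, a continuation (continuous curve of shapes) of Lagrange relative
equilibria reaches the point `p`. -/
def LREContinuationReaches (m : Fin 3 → ℝ) (p : Shape) : Prop :=
  ∃ γ : ℝ → Shape, ContinuousOn γ (Icc 0 1) ∧ γ 0 = p ∧ ∀ t ∈ Ioc 0 1, γ t ∈ lreShapes m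

end CurvedThreeBody

end

/-!
A uniform rotation about the `z`-axis is a solution if and only if the forces balance in the
rotating frame (`isSolution_rotZ_iff`). For three masses that are not on a common great circle the
balance can be solved for the axis: it has the direction of `∑ j, m j * x j • Q j` with
`x i = sin (σ i) ^ 3`, and what remains is a condition on the shape alone, namely that `x` is an
eigenvector, with a positive eigenvalue, of `G M`, where `G` is the Gram matrix of the three
positions and `M` the diagonal matrix of the masses. This condition is `IsLagrangeShape`. It makes
sense on the plane `σ₃ = σ₁ + σ₂` as well, where the Gram determinant vanishes and the configuration
lies on a meridian.

*Necessity.* On the plane the kernel of `G` is spanned by `(sin σ₁, sin σ₂, - sin σ₃)`. A limit of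
Lagrange shapes still satisfies `IsLagrangeShape` there (`LREContinuationReaches.isLagrangeShape`),
hence `x` is in the image of `G`, i.e. `sin σ₁ ^ 4 + sin σ₂ ^ 4 = sin σ₃ ^ 4`, and this is the
equation `h = 0` (`h_eq_zero_iff`). On the curve `h = 0` the eigenvector condition reduces to one
linear equation for the masses (`CurveData.isLagrangeShape_iff`).

*Lagrange relative equilibria near the plane.* Near such a point `p` the Lagrange shapes are the
common zeros of two functions `lagrangeK` and `lagrangeL`. Their derivatives at `p` are polynomials
in a parameter `w` of the curve, in the masses, and in the asymmetry `d = u² - v²`. The common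
zeros form an arc that crosses the plane, except if the expression `tangency` vanishes. In that case
they still form an arc if `d ≠ 0`, and a continuation of Lagrange relative equilibria that reaches
`p` has to run along one of its halves (`exists_half_arc`); if `d = 0` the isosceles shapes give an
arc that crosses the plane. The side of the plane where the triangle inequality holds is the one
where the Gram determinant is positive. There each shape has two mirror-symmetric configurations of
opposite orientations, which depend continuously on the shape and merge on the plane
(`hasLRECoupling_of_arc`).

*Euler relative equilibria near `p`.* On the plane, the existence of a suitable axis on the great
circle through the masses is one equation `eulerG = 0` for the shape (`mem_ereShapes`). It holds
at `p`, and its derivative along the plane does not vanish if `d ≠ 0`; if `d = 0` the isosceles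
shapes are solutions (`CurveData.hasEREContinuation`).

*Sufficiency.* At a point with `h = 0` the admissible masses form a cone with two parameters `r`,
`t` (`MassData`), hence a line of mass ratios; for `2 * t ≤ r` the expression `tangency` is positive
(`tangency_pos`), which gives a segment of bifurcations (`exists_segment`).
-/

open Set

noncomputable section

namespace CurvedThreeBody

/-! ### Relative equilibria as balanced configurations -/

theorem inner_eq_sum (v w : E3) : inner ℝ v w = v 0 * w 0 + v 1 * w 1 + v 2 * w 2 := by
  simp [PiLp.inner_apply, Fin.sum_univ_three, mul_comm]

theorem norm_sq_eq_sum (v : E3) : ‖v‖ ^ 2 = v 0 ^ 2 + v 1 ^ 2 + v 2 ^ 2 := by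
  simp [EuclideanSpace.norm_sq_eq, Fin.sum_univ_three]

theorem inner_rotZ (a : ℝ) (v w : E3) : inner ℝ (rotZ a v) (rotZ a w) = inner ℝ v w := by
  simp only [inner_eq_sum, rotZ, Matrix.cons_val_zero, Matrix.cons_val_one,
    Matrix.cons_val]
  linear_combination (v 0 * w 0 + v 1 * w 1) * Real.sin_sq_add_cos_sq a

theorem norm_rotZ (a : ℝ) (v : E3) : ‖rotZ a v‖ = ‖v‖ := by
  rw [norm_eq_sqrt_real_inner, norm_eq_sqrt_real_inner, inner_rotZ]

theorem rotZ_eq_smul (a : ℝ) (v : E3) :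
    rotZ a v = Real.cos a • (!₂[v 0, v 1, 0] : E3) + Real.sin a • (!₂[-v 1, v 0, 0] : E3)
      + !₂[0, 0, v 2] := by
  ext k
  fin_cases k <;> simp [rotZ] <;> ring

/-- The rotation about the `z`-axis as a linear map. -/
def rotZLinear (a : ℝ) : E3 →ₗ[ℝ] E3 where
  toFun := rotZ a
  map_add' x y := by ext k; fin_cases k <;> simp [rotZ] <;> ring
  map_smul' c x := by ext k; fin_cases k <;> simp [rotZ] <;> ring

theorem hasDerivAt_rotZ (ω : ℝ) (v : E3) (t : ℝ) :
    HasDerivAt (fun t => rotZ (ω * t) v) (ω • rotZ (ω * t) !₂[-v 1, v 0, 0]) t := by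
  have h1 : HasDerivAt (fun t : ℝ => ω * t) ω t := by
    simpa using (hasDerivAt_id t).const_mul ω
  have h2 := ((h1.cos.smul_const (!₂[v 0, v 1, 0] : E3)).add
    (h1.sin.smul_const (!₂[-v 1, v 0, 0] : E3))).add_const (!₂[0, 0, v 2] : E3)
  simp only [rotZ_eq_smul _ v]
  refine h2.congr_deriv ?_
  ext k
  fin_cases k <;> simp [rotZ] <;> ring

theorem deriv_rotZ (ω : ℝ) (v : E3) :
    deriv (fun t => rotZ (ω * t) v) = fun t => ω • rotZ (ω * t) !₂[-v 1, v 0, 0] :=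
  funext fun t => (hasDerivAt_rotZ ω v t).deriv

theorem deriv_deriv_rotZ (ω : ℝ) (v : E3) (t : ℝ) :
    deriv (deriv (fun t => rotZ (ω * t) v)) t = (-ω ^ 2) • rotZ (ω * t) !₂[v 0, v 1, 0] := by
  rw [deriv_rotZ]
  have h := (hasDerivAt_rotZ ω !₂[-v 1, v 0, 0] t).const_smul ω
  refine (h.congr_deriv ?_).deriv
  ext k
  fin_cases k <;> simp [rotZ] <;> ring

/-- The balance of forces in the rotating frame: the centrifugal force, projected to the tangent
plane of the sphere at each mass, cancels the attraction of the other two masses. -/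
def IsBalanced (m : Fin 3 → ℝ) (Q : Config) (ω : ℝ) : Prop :=
  ∀ i, (ω ^ 2 * Q i 2) • (axis - Q i 2 • Q i) =
    ∑ j ∈ Finset.univ.erase i, (m j / (√(1 - (inner ℝ (Q i) (Q j)) ^ 2)) ^ 3) •
      (Q j - (inner ℝ (Q i) (Q j)) • Q i)

/-- By rotation invariance the equations of motion along a uniform rotation reduce to the balance of
forces at one time. -/
theorem isSolution_rotZ_iff {m : Fin 3 → ℝ} (hm : ∀ k, 0 < m k) (Q : Config) (ω : ℝ) :
    IsSolution m (fun i t => rotZ (ω * t) (Q i)) ↔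
      (∀ i, ‖Q i‖ = 1) ∧ (∀ i j, i ≠ j → (inner ℝ (Q i) (Q j)) ^ 2 ≠ 1) ∧ IsBalanced m Q ω := by
  have key : ∀ (i : Fin 3) (t : ℝ), ‖Q i‖ = 1 →
      ((m i • deriv (deriv (fun t => rotZ (ω * t) (Q i))) t =
      (∑ j ∈ Finset.univ.erase i,
        (m i * m j / (√(1 - (inner ℝ (rotZ (ω * t) (Q i)) (rotZ (ω * t) (Q j))) ^ 2)) ^ 3) •
        (rotZ (ω * t) (Q j) - (inner ℝ (rotZ (ω * t) (Q i)) (rotZ (ω * t) (Q j))) •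
          rotZ (ω * t) (Q i)))
      - (m i * ‖deriv (fun t => rotZ (ω * t) (Q i)) t‖ ^ 2) • rotZ (ω * t) (Q i)) ↔
      rotZ (ω * t) ((ω ^ 2 * Q i 2) • (axis - Q i 2 • Q i)) =
        rotZ (ω * t) (∑ j ∈ Finset.univ.erase i,
          (m j / (√(1 - (inner ℝ (Q i) (Q j)) ^ 2)) ^ 3) •
          (Q j - (inner ℝ (Q i) (Q j)) • Q i))) := by
    intro i t hi
    have hn : ‖deriv (fun t => rotZ (ω * t) (Q i)) t‖ ^ 2 = ω ^ 2 * (1 - Q i 2 ^ 2) := by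
      have h1 := norm_sq_eq_sum (Q i)
      rw [hi] at h1
      rw [deriv_rotZ]
      simp only [norm_smul, norm_rotZ, mul_pow, norm_sq_eq_sum]
      simp only [Real.norm_eq_abs, sq_abs, Matrix.cons_val_zero,
        Matrix.cons_val_one, Matrix.cons_val]
      linear_combination (-ω ^ 2) * h1
    rw [hn, deriv_deriv_rotZ]
    simp only [inner_rotZ]
    have hsum : (∑ j ∈ Finset.univ.erase i,
        (m i * m j / (√(1 - (inner ℝ (Q i) (Q j)) ^ 2)) ^ 3) •
        (rotZ (ω * t) (Q j) - (inner ℝ (Q i) (Q j)) • rotZ (ω * t) (Q i))) =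
        m i • rotZLinear (ω * t) (∑ j ∈ Finset.univ.erase i,
          (m j / (√(1 - (inner ℝ (Q i) (Q j)) ^ 2)) ^ 3) •
          (Q j - (inner ℝ (Q i) (Q j)) • Q i)) := by
      rw [map_sum, Finset.smul_sum]
      refine Finset.sum_congr rfl fun j _ => ?_
      rw [map_smul, map_sub, map_smul, smul_smul, mul_div_assoc]
      rfl
    rw [hsum]
    generalize ∑ j ∈ Finset.univ.erase i, (m j / (√(1 - (inner ℝ (Q i) (Q j)) ^ 2)) ^ 3) •
          (Q j - (inner ℝ (Q i) (Q j)) • Q i) = S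
    have hax : (!₂[Q i 0, Q i 1, 0] : E3) = Q i - Q i 2 • axis := by
      ext k
      fin_cases k <;> simp [axis]
    have e1 : m i • (-ω ^ 2) • rotZ (ω * t) !₂[Q i 0, Q i 1, 0] =
        m i • (rotZLinear (ω * t) ((ω ^ 2 * Q i 2) • (axis - Q i 2 • Q i)) -
          (ω ^ 2 * (1 - Q i 2 ^ 2)) • rotZ (ω * t) (Q i)) := by
      rw [hax]
      change m i • (-ω ^ 2) • rotZLinear (ω * t) _ =
        m i • (_ - (ω ^ 2 * (1 - Q i 2 ^ 2)) • rotZLinear (ω * t) (Q i))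
      rw [← map_smul, ← map_smul, ← map_smul, ← map_sub, ← map_smul]
      congr 1
      module
    rw [e1, mul_smul (m i), ← smul_sub, (smul_right_injective E3 (hm i).ne').eq_iff, sub_left_inj]
    rfl
  constructor
  · rintro ⟨h1, h2, -, h4⟩
    have h0 : ∀ u : E3, rotZ (ω * 0) u = u := by
      intro u; ext k; fin_cases k <;> simp [rotZ]
    have h1' : ∀ i, ‖Q i‖ = 1 := fun i => by simpa only [norm_rotZ] using h1 i 0
    refine ⟨h1', fun i j hij => by simpa only [inner_rotZ] using h2 i j 0 hij, fun i => ?_⟩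
    have := (key i 0 (h1' i)).1 (h4 i 0)
    rwa [h0, h0] at this
  · rintro ⟨h1, h2, h3⟩
    refine ⟨fun i t => by rw [norm_rotZ, h1], fun i j t hij => ?_, fun i => ?_, fun i t => ?_⟩
    · rw [inner_rotZ]
      exact h2 i j hij
    · simp only [rotZ_eq_smul _ (Q i)]
      fun_prop
    · exact (key i t (h1 i)).2 (congrArg _ (h3 i))

/-! ### Shapes and the Gram matrix -/

/-- Row `i` of `G M x`, where `G` is the Gram matrix of a configuration of shape `σ`, `M` the
diagonal matrix of the masses and `x i = sin (σ i) ^ 3`. -/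
def row (m : Fin 3 → ℝ) (σ : Shape) (i : Fin 3) : ℝ :=
  m i * Real.sin (σ i) ^ 3 + m (i + 1) * Real.sin (σ (i + 1)) ^ 3 * Real.cos (σ (i + 2))
    + m (i + 2) * Real.sin (σ (i + 2)) ^ 3 * Real.cos (σ (i + 1))

/-- The equation for the shapes of Lagrange relative equilibria: the vector `x` with
`x i = sin (σ i) ^ 3` is an eigenvector of `G M` with a positive eigenvalue. On the plane
`σ₃ = σ₁ + σ₂` it describes the meridian configurations that are limits of Lagrange relative
equilibria. -/
def IsLagrangeShape (m : Fin 3 → ℝ) (σ : Shape) : Prop :=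
  ∃ l : ℝ, 0 < l ∧ ∀ i, row m σ i = l * Real.sin (σ i) ^ 3

/-- The determinant of the Gram matrix of a configuration of shape `σ`. -/
def gramDet (σ : Shape) : ℝ :=
  1 - Real.cos (σ 0) ^ 2 - Real.cos (σ 1) ^ 2 - Real.cos (σ 2) ^ 2
    + 2 * Real.cos (σ 0) * Real.cos (σ 1) * Real.cos (σ 2)

theorem sum_erase_fin_three {M : Type*} [AddCommMonoid M] (f : Fin 3 → M) (i : Fin 3) :
    ∑ j ∈ Finset.univ.erase i, f j = f (i + 1) + f (i + 2) := by
  have h : Finset.univ.erase i = {i + 1, i + 2} := by decide +revert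
  have h' : i + 1 ≠ i + 2 := by decide +revert
  rw [h, Finset.sum_pair h']

theorem sin_pos_of_mem_U {σ : Shape} (hσ : σ ∈ U) (k : Fin 3) : 0 < Real.sin (σ k) :=
  Real.sin_pos_of_pos_of_lt_pi (hσ k).1 (hσ k).2

theorem shape_eq_iff {Q : Config} (hQ : ∀ i, ‖Q i‖ = 1) {σ : Shape} (hσ : σ ∈ U) :
    shape Q = σ ↔ ∀ k, inner ℝ (Q (k + 1)) (Q (k + 2)) = Real.cos (σ k) := by
  constructor
  · rintro rfl k
    rw [shape, InnerProductGeometry.cos_angle, hQ, hQ]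
    simp
  · intro hk
    ext k
    rw [shape, InnerProductGeometry.angle, hQ, hQ, hk]
    simp [Real.arccos_cos (hσ k).1.le (hσ k).2.le]

theorem shape_mem_U {Q : Config} (hQ : ∀ i, ‖Q i‖ = 1)
    (h : ∀ i j, i ≠ j → (inner ℝ (Q i) (Q j)) ^ 2 ≠ 1) : shape Q ∈ U := by
  intro k
  have h1 : (inner ℝ (Q (k + 1)) (Q (k + 2))) ^ 2 ≠ 1 := h _ _ (by decide +revert)
  have h2 : Real.cos (shape Q k) = inner ℝ (Q (k + 1)) (Q (k + 2)) := by
    rw [shape, InnerProductGeometry.cos_angle, hQ, hQ]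
    simp
  refine ⟨lt_of_le_of_ne (InnerProductGeometry.angle_nonneg _ _) fun h0 => h1 ?_,
    lt_of_le_of_ne (InnerProductGeometry.angle_le_pi _ _) fun h0 => h1 ?_⟩
  · rw [← h2, ← h0]; simp
  · rw [← h2, h0]; simp

/-- The inner products of a configuration of shape `σ`, indexed from one of the masses. -/
theorem inner_of_shape {Q : Config} {σ : Shape}
    (h : ∀ k, inner ℝ (Q (k + 1)) (Q (k + 2)) = Real.cos (σ k)) (i : Fin 3) :
    inner ℝ (Q i) (Q (i + 1)) = Real.cos (σ (i + 2)) ∧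
      inner ℝ (Q i) (Q (i + 2)) = Real.cos (σ (i + 1)) := by
  have h1 : i + 2 + 1 = i := by decide +revert
  have h2 : i + 2 + 2 = i + 1 := by decide +revert
  have h3 : i + 1 + 1 = i + 2 := by decide +revert
  have h4 : i + 1 + 2 = i := by decide +revert
  constructor
  · rw [← h (i + 2), h1, h2]
  · rw [← h (i + 1), h3, h4, real_inner_comm]

theorem inner_sq_ne_one {Q : Config} {σ : Shape} (hσ : σ ∈ U)
    (h : ∀ k, inner ℝ (Q (k + 1)) (Q (k + 2)) = Real.cos (σ k)) {i j : Fin 3} (hij : i ≠ j) :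
    (inner ℝ (Q i) (Q j)) ^ 2 ≠ 1 := by
  have hcos : ∀ k, Real.cos (σ k) ^ 2 ≠ 1 := by
    intro k h1
    have h2 := Real.sin_sq_add_cos_sq (σ k)
    nlinarith [pow_pos (sin_pos_of_mem_U hσ k) 2]
  rcases (by decide : ∀ i j : Fin 3, i ≠ j → j = i + 1 ∨ j = i + 2) i j hij with rfl | rfl
  · rw [(inner_of_shape h i).1]; exact hcos _
  · rw [(inner_of_shape h i).2]; exact hcos _

theorem isBalanced_iff {m : Fin 3 → ℝ} {Q : Config} {σ : Shape} (hσ : σ ∈ U)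
    (h : ∀ k, inner ℝ (Q (k + 1)) (Q (k + 2)) = Real.cos (σ k)) (ω : ℝ) :
    IsBalanced m Q ω ↔ ∀ i, (ω ^ 2 * Q i 2) • (axis - Q i 2 • Q i) =
      (m (i + 1) / Real.sin (σ (i + 2)) ^ 3) • (Q (i + 1) - Real.cos (σ (i + 2)) • Q i) +
      (m (i + 2) / Real.sin (σ (i + 1)) ^ 3) • (Q (i + 2) - Real.cos (σ (i + 1)) • Q i) := by
  have hs : ∀ k, √(1 - Real.cos (σ k) ^ 2) = Real.sin (σ k) := by
    intro k
    rw [← Real.sin_sq, Real.sqrt_sq (sin_pos_of_mem_U hσ k).le]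
  unfold IsBalanced
  refine forall_congr' fun i => ?_
  rw [sum_erase_fin_three, (inner_of_shape h i).1, (inner_of_shape h i).2, hs, hs]

/-- The Gram determinant is the square of the determinant of the position vectors. -/
theorem orientation_sq {Q : Config} (hQ : ∀ i, ‖Q i‖ = 1) {σ : Shape}
    (h : ∀ k, inner ℝ (Q (k + 1)) (Q (k + 2)) = Real.cos (σ k)) :
    orientation Q ^ 2 = gramDet σ := by
  have n : ∀ i, Q i 0 ^ 2 + Q i 1 ^ 2 + Q i 2 ^ 2 = 1 := fun i => by
    rw [← norm_sq_eq_sum, hQ]; norm_num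
  have i0 := inner_of_shape h 0
  have i1 := inner_of_shape h 1
  simp only [inner_eq_sum] at i0 i1
  simp only [Fin.isValue, Fin.reduceAdd, zero_add] at i0 i1
  rw [gramDet, ← i0.1, ← i0.2, ← i1.1, orientation, Matrix.det_fin_three]
  simp only [Matrix.of_apply]
  have n0 := n 0
  have n1 := n 1
  have n2 := n 2
  have key : ∀ a b c : ℝ, a = 1 → b = 1 → c = 1 → ∀ x y z : ℝ,
      1 - x ^ 2 - y ^ 2 - z ^ 2 + 2 * x * y * z =
      a * b * c - a * x ^ 2 - b * y ^ 2 - c * z ^ 2 + 2 * x * y * z := by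
    rintro a b c rfl rfl rfl x y z; ring
  rw [key _ _ _ n0 n1 n2]
  ring

theorem not_onGeodesic_iff {Q : Config} : ¬ OnGeodesic Q ↔ orientation Q ≠ 0 := by
  rw [not_iff_not, orientation, ← Matrix.exists_mulVec_eq_zero_iff]
  have key : ∀ v : Fin 3 → ℝ, (Matrix.of fun i j => Q i j).mulVec v = 0 ↔
      ∀ i, inner ℝ (WithLp.toLp 2 v : E3) (Q i) = 0 := by
    intro v
    rw [funext_iff]
    refine forall_congr' fun i => ?_
    rw [inner_eq_sum, Matrix.mulVec, dotProduct, Fin.sum_univ_three]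
    simp only [Matrix.of_apply, Pi.zero_apply, mul_comm]
  constructor
  · rintro ⟨n, hn, h⟩
    refine ⟨n, fun h0 => hn ?_, (key _).2 h⟩
    ext k
    exact congrFun h0 k
  · rintro ⟨v, hv, h⟩
    refine ⟨WithLp.toLp 2 v, fun h0 => hv ?_, (key _).1 h⟩
    ext k
    exact congrArg (fun u : E3 => u k) h0

/-! ### The shapes of Lagrange relative equilibria -/

theorem exists_axis_eq_sum {Q : Config} (hQ : orientation Q ≠ 0) :
    ∃ a : Fin 3 → ℝ, axis = ∑ j, a j • Q j := by
  have hu : IsUnit (Matrix.of fun i j => Q i j).det := isUnit_iff_ne_zero.2 hQ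
  refine ⟨Matrix.vecMul axis (Matrix.of fun i j => Q i j)⁻¹, ?_⟩
  have h := Matrix.vecMul_vecMul (axis : Fin 3 → ℝ) (Matrix.of fun i j => Q i j)⁻¹
    (Matrix.of fun i j => Q i j)
  rw [Matrix.nonsing_inv_mul _ hu, Matrix.vecMul_one] at h
  ext k
  have hk := congrFun h k
  rw [← hk, Matrix.vecMul, dotProduct]
  simp [Fin.sum_univ_three]

theorem eq_zero_of_sum_smul_eq_zero {Q : Config} (hQ : orientation Q ≠ 0) {b : Fin 3 → ℝ}
    (hb : ∑ j, b j • Q j = 0) : b = 0 := by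
  refine Matrix.eq_zero_of_vecMul_eq_zero hQ ?_
  ext k
  have hk := congrArg (fun u : E3 => u k) hb
  simpa [Matrix.vecMul, dotProduct, Fin.sum_univ_three] using hk

theorem sum_fin_three_cyclic {M : Type*} [AddCommMonoid M] (f : Fin 3 → M) (i : Fin 3) :
    ∑ j, f j = f i + f (i + 1) + f (i + 2) := by
  rw [← Finset.add_sum_erase _ _ (Finset.mem_univ i), sum_erase_fin_three, add_assoc]

theorem inner_axis (v : E3) : inner ℝ axis v = v 2 := by
  simp [inner_eq_sum, axis]

/-- The shape of a Lagrange relative equilibrium satisfies the eigenvector equation. The position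
vectors are a basis, so that the equations of motion can be compared coefficient by coefficient. -/
theorem IsLRE.isLagrangeShape {m : Fin 3 → ℝ} (hm : ∀ k, 0 < m k) {Q : Config}
    (h : IsLRE m Q) :
    shape Q ∈ U ∧ IsLagrangeShape m (shape Q) ∧ 0 < gramDet (shape Q) := by
  obtain ⟨⟨ω, hsol⟩, hgeo⟩ := h
  rw [isSolution_rotZ_iff hm] at hsol
  obtain ⟨hn, hc, hbal⟩ := hsol
  have hU := shape_mem_U hn hc
  have hin := (shape_eq_iff hn hU).1 rfl
  rw [not_onGeodesic_iff] at hgeo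
  refine ⟨hU, ?_, ?_⟩
  swap
  · rw [← orientation_sq hn hin]
    positivity
  rw [isBalanced_iff hU hin] at hbal
  generalize shape Q = σ at *
  obtain ⟨a, ha⟩ := exists_axis_eq_sum hgeo
  have hs := sin_pos_of_mem_U hU
  have hz : ∀ i, Q i 2 = a i + a (i + 1) * Real.cos (σ (i + 2))
      + a (i + 2) * Real.cos (σ (i + 1)) := by
    intro i
    rw [← inner_axis, ha, sum_fin_three_cyclic _ i, inner_add_left, inner_add_left,
      inner_smul_left, inner_smul_left, inner_smul_left, real_inner_self_eq_norm_sq, hn,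
      real_inner_comm (Q i), real_inner_comm (Q i), (inner_of_shape hin i).1,
      (inner_of_shape hin i).2]
    simp
  -- the coefficients of the other two position vectors in the force balance at mass `i`
  have hco : ∀ i, ω ^ 2 * Q i 2 * a (i + 1) * Real.sin (σ (i + 2)) ^ 3 = m (i + 1) ∧
      ω ^ 2 * Q i 2 * a (i + 2) * Real.sin (σ (i + 1)) ^ 3 = m (i + 2) := by
    intro i
    have hb := hbal i
    rw [ha, sum_fin_three_cyclic _ i] at hb
    set A := m (i + 1) / Real.sin (σ (i + 2)) ^ 3
    set B := m (i + 2) / Real.sin (σ (i + 1)) ^ 3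
    let b : Fin 3 → ℝ := fun j => if j = i then ω ^ 2 * Q i 2 * (a i - Q i 2)
      + A * Real.cos (σ (i + 2)) + B * Real.cos (σ (i + 1))
      else ω ^ 2 * Q i 2 * a j - if j = i + 1 then A else B
    obtain ⟨n1, n2, n3⟩ := (by decide : ∀ i : Fin 3, i + 1 ≠ i ∧ i + 2 ≠ i ∧ i + 2 ≠ i + 1) i
    have hb0 : b = 0 := by
      refine eq_zero_of_sum_smul_eq_zero hgeo ?_
      rw [sum_fin_three_cyclic _ i]
      simp only [b, if_true, n1, n2, n3, if_false]
      rw [← sub_eq_zero] at hb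
      rw [← hb]
      module
    have h1 := congrFun hb0 (i + 1)
    have h2 := congrFun hb0 (i + 2)
    simp only [b, if_true, n1, n2, n3, if_false, Pi.zero_apply, sub_eq_zero] at h1 h2
    have p1 := (hs (i + 2)).ne'
    have p2 := (hs (i + 1)).ne'
    rw [h1, h2]
    constructor <;> simp only [A, B] <;> field_simp
  -- the heights of the masses are proportional to `x`
  have hprop : ∀ i, Q i 2 * Real.sin (σ (i + 2)) ^ 3 = Q (i + 2) 2 * Real.sin (σ i) ^ 3 := by
    intro i
    obtain ⟨e1, e2⟩ := (by decide : ∀ i : Fin 3, i + 2 + 2 = i + 1 ∧ i + 2 + 1 = i) i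
    have h1 := (hco i).1
    have h2 := (hco (i + 2)).2
    rw [e1, e2] at h2
    have h3 : ω ^ 2 * a (i + 1) ≠ 0 := by
      intro h0
      refine (hm (i + 1)).ne' ?_
      rw [← h1]
      linear_combination (Q i 2 * Real.sin (σ (i + 2)) ^ 3) * h0
    refine mul_left_cancel₀ h3 ?_
    linear_combination h1 - h2
  obtain ⟨k, hk⟩ : ∃ k : ℝ, ∀ i, Q i 2 = k * Real.sin (σ i) ^ 3 := by
    refine ⟨Q 0 2 / Real.sin (σ 0) ^ 3, fun i => ?_⟩
    have p0 := (hs 0).ne'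
    have h1 := hprop 0
    have h2 := hprop 1
    simp only [Fin.isValue, Fin.reduceAdd, zero_add] at h1 h2
    field_simp
    fin_cases i
    · rfl
    · simp only [Fin.mk_one, Fin.isValue]; linear_combination h2
    · simp only [Fin.reduceFinMk, Fin.isValue]; linear_combination -h1
  set S := Real.sin (σ 0) ^ 3 * Real.sin (σ 1) ^ 3 * Real.sin (σ 2) ^ 3 with hS
  have hSpos : 0 < S := by have := hs 0; have := hs 1; have := hs 2; positivity
  have hy : ∀ j, m j * Real.sin (σ j) ^ 3 = ω ^ 2 * k * S * a j := by
    have g : ∀ i, m (i + 1) = ω ^ 2 * k * (Real.sin (σ i) ^ 3 * Real.sin (σ (i + 2)) ^ 3)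
        * a (i + 1) := fun i => by
      rw [← (hco i).1, hk]; ring
    have g0 := g 0
    have g1 := g 1
    have g2 := g 2
    simp only [Fin.isValue, Fin.reduceAdd, zero_add] at g0 g1 g2
    intro j
    fin_cases j
    · simp only [Fin.zero_eta, Fin.isValue]; rw [g2, hS]; ring
    · simp only [Fin.mk_one, Fin.isValue]; rw [g0, hS]; ring
    · simp only [Fin.reduceFinMk, Fin.isValue]; rw [g1, hS]; ring
  refine ⟨ω ^ 2 * k ^ 2 * S, ?_, fun i => ?_⟩
  · have hωk : ω * k ≠ 0 := by
      intro h0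
      have := hy 0
      have hp := mul_pos (hm 0) (pow_pos (hs 0) 3)
      rw [this] at hp
      refine hp.ne' ?_
      linear_combination (ω * S * a 0) * h0
    rw [← mul_pow]
    positivity
  · rw [row, hy, hy, hy]
    have := hz i
    rw [hk] at this
    linear_combination (-(ω ^ 2 * k * S)) * this

/-- A configuration of a Lagrange shape is a relative equilibrium as soon as the axis is placed in
the direction of `∑ j, m j * x j • Q j`. No independence of the positions is needed, so that this
covers the meridian configurations as well. -/
theorem isRE_of_isLagrangeShape {m : Fin 3 → ℝ} (hm : ∀ k, 0 < m k) {Q : Config} {σ : Shape}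
    (hσ : σ ∈ U) (hn : ∀ i, ‖Q i‖ = 1)
    (hin : ∀ k, inner ℝ (Q (k + 1)) (Q (k + 2)) = Real.cos (σ k)) {l β : ℝ}
    (hrow : ∀ i, row m σ i = l * Real.sin (σ i) ^ 3)
    (hax : axis = ∑ j, (β * (m j * Real.sin (σ j) ^ 3)) • Q j) : IsRE m Q := by
  have hs := sin_pos_of_mem_U hσ
  have hz : ∀ i, Q i 2 = β * l * Real.sin (σ i) ^ 3 := by
    intro i
    have := hrow i
    rw [row] at this
    rw [← inner_axis, hax, sum_fin_three_cyclic _ i, inner_add_left, inner_add_left,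
      inner_smul_left, inner_smul_left, inner_smul_left, real_inner_self_eq_norm_sq, hn,
      real_inner_comm (Q i), real_inner_comm (Q i), (inner_of_shape hin i).1,
      (inner_of_shape hin i).2]
    simp only [conj_trivial]
    linear_combination β * this
  set S := Real.sin (σ 0) ^ 3 * Real.sin (σ 1) ^ 3 * Real.sin (σ 2) ^ 3 with hS
  have hSpos : 0 < S := by have := hs 0; have := hs 1; have := hs 2; positivity
  set M := m 0 * Real.sin (σ 0) ^ 6 + m 1 * Real.sin (σ 1) ^ 6 + m 2 * Real.sin (σ 2) ^ 6 with hM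
  have hMpos : 0 < M := by
    have := hs 0; have := hs 1; have := hs 2
    have := hm 0; have := hm 1; have := hm 2
    positivity
  have hβ : β ^ 2 * l * M = 1 := by
    have h1 : inner ℝ axis axis = (1 : ℝ) := by rw [inner_axis]; simp [axis]
    have h2 := congrArg (fun v => inner ℝ axis v) hax
    simp only [h1, inner_axis, Fin.sum_univ_three, PiLp.add_apply, PiLp.smul_apply, smul_eq_mul,
      hz] at h2
    rw [hM]
    linear_combination -h2
  refine ⟨√(M / S), (isSolution_rotZ_iff hm Q _).2 ⟨hn, fun _ _ => inner_sq_ne_one hσ hin, ?_⟩⟩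
  · rw [isBalanced_iff hσ hin]
    intro i
    rw [Real.sq_sqrt (by positivity)]
    have hM1 : M * β ^ 2 * l = 1 := by linear_combination hβ
    have hSi : S = Real.sin (σ i) ^ 3 * Real.sin (σ (i + 1)) ^ 3 * Real.sin (σ (i + 2)) ^ 3 := by
      rw [hS]
      fin_cases i <;> simp <;> ring
    have p0 := (hs i).ne'
    have p1 := (hs (i + 1)).ne'
    have p2 := (hs (i + 2)).ne'
    have c1 : M / S * Q i 2 * (β * (m (i + 1) * Real.sin (σ (i + 1)) ^ 3)) =
        m (i + 1) / Real.sin (σ (i + 2)) ^ 3 := by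
      rw [hz, hSi]
      field_simp
      linear_combination m (i + 1) * hM1
    have c2 : M / S * Q i 2 * (β * (m (i + 2) * Real.sin (σ (i + 2)) ^ 3)) =
        m (i + 2) / Real.sin (σ (i + 1)) ^ 3 := by
      rw [hz, hSi]
      field_simp
      linear_combination m (i + 2) * hM1
    have hzi : Q i 2 = β * (m i * Real.sin (σ i) ^ 3)
        + β * (m (i + 1) * Real.sin (σ (i + 1)) ^ 3) * Real.cos (σ (i + 2))
        + β * (m (i + 2) * Real.sin (σ (i + 2)) ^ 3) * Real.cos (σ (i + 1)) := by
      have := hrow i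
      rw [row] at this
      rw [hz]
      linear_combination -β * this
    -- in terms of the coefficients of the axis, the balance at mass `i` is an identity
    rw [← c1, ← c2]
    rw [hax, sum_fin_three_cyclic _ i]
    generalize M / S * Q i 2 = W
    rw [hzi]
    module

/-! ### Reconstruction of a configuration from its shape -/

/-- The norm of `x` for the inner product weighted by the masses, squared. -/
def weight (m : Fin 3 → ℝ) (σ : Shape) : ℝ := ∑ j, m j * Real.sin (σ j) ^ 6

/-- The eigenvalue of `G M` for the eigenvector `x`, read off from the last row. -/
def eigen (m : Fin 3 → ℝ) (σ : Shape) : ℝ := row m σ 2 / Real.sin (σ 2) ^ 3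

/-- The height of mass `i` above the equator when the axis is the normalized
`∑ j, m j * x j • Q j`. -/
def height (m : Fin 3 → ℝ) (σ : Shape) (i : Fin 3) : ℝ :=
  √(eigen m σ / weight m σ) * Real.sin (σ i) ^ 3

/-- The distance of the first mass from the axis. -/
def radius (m : Fin 3 → ℝ) (σ : Shape) : ℝ := √(1 - height m σ 0 ^ 2)

/-- The first horizontal coordinate of the second mass, when the first mass lies in the half-plane
`y = 0`, `x > 0`. -/
def abscissa (m : Fin 3 → ℝ) (σ : Shape) : ℝ :=
  (Real.cos (σ 2) - height m σ 0 * height m σ 1) / radius m σ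

/-- The distance of the second mass from the meridian plane of the first one. -/
def ordinate (m : Fin 3 → ℝ) (σ : Shape) : ℝ :=
  √(1 - height m σ 1 ^ 2 - abscissa m σ ^ 2)

/-- The configuration of shape `σ` whose first mass lies in the half-plane `y = 0`, `x > 0`, whose
second mass has the second coordinate `y`, and whose axis has the direction of
`∑ j, m j * x j • Q j`. -/
def config (m : Fin 3 → ℝ) (σ : Shape) (y : ℝ) : Config :=
  ![!₂[radius m σ, 0, height m σ 0], !₂[abscissa m σ, y, height m σ 1],
    !₂[-(m 0 * Real.sin (σ 0) ^ 3 * radius m σ + m 1 * Real.sin (σ 1) ^ 3 * abscissa m σ)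
        / (m 2 * Real.sin (σ 2) ^ 3),
      -(m 1 * Real.sin (σ 1) ^ 3 * y) / (m 2 * Real.sin (σ 2) ^ 3), height m σ 2]]

theorem weight_pos {m : Fin 3 → ℝ} (hm : ∀ k, 0 < m k) {σ : Shape} (hσ : σ ∈ U) :
    0 < weight m σ :=
  Finset.sum_pos (fun j _ => mul_pos (hm j) (pow_pos (sin_pos_of_mem_U hσ j) 6))
    Finset.univ_nonempty

theorem eigen_eq {m : Fin 3 → ℝ} {σ : Shape} (hσ : σ ∈ U) {l : ℝ}
    (hrow : ∀ i, row m σ i = l * Real.sin (σ i) ^ 3) : eigen m σ = l := by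
  rw [eigen, hrow, mul_div_cancel_right₀]
  exact (pow_pos (sin_pos_of_mem_U hσ 2) 3).ne'

/-- Projecting along the axis `∑ j, a j • Q j` multiplies the Gram determinant of the first two
vectors by `a₃²` times the full Gram determinant. -/
theorem gram_minor_projected {a b c x y z a0 a1 a2 : ℝ} (hx : x = a0 + a1 * c + a2 * b)
    (hy : y = a0 * c + a1 + a2 * a) (hz : z = a0 * b + a1 * a + a2)
    (h : a0 * x + a1 * y + a2 * z = 1) :
    (1 - x ^ 2) * (1 - y ^ 2) - (c - x * y) ^ 2 =
      a2 ^ 2 * (1 - a ^ 2 - b ^ 2 - c ^ 2 + 2 * a * b * c) := by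
  subst hx hy hz
  linear_combination (-(1 - c ^ 2)) * h

section
variable {m : Fin 3 → ℝ} {σ : Shape}

/-- The heights are the inner products with the axis `β • ∑ j, m j * x j • Q j`, which has norm
one. -/
theorem height_facts (hm : ∀ k, 0 < m k) (hσ : σ ∈ U) (h : IsLagrangeShape m σ) :
    ∃ β, 0 < β ∧
      height m σ 0 = β * (m 0 * Real.sin (σ 0) ^ 3) + β * (m 1 * Real.sin (σ 1) ^ 3) *
        Real.cos (σ 2) + β * (m 2 * Real.sin (σ 2) ^ 3) * Real.cos (σ 1) ∧
      height m σ 1 = β * (m 0 * Real.sin (σ 0) ^ 3) * Real.cos (σ 2) +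
        β * (m 1 * Real.sin (σ 1) ^ 3) + β * (m 2 * Real.sin (σ 2) ^ 3) * Real.cos (σ 0) ∧
      height m σ 2 = β * (m 0 * Real.sin (σ 0) ^ 3) * Real.cos (σ 1) +
        β * (m 1 * Real.sin (σ 1) ^ 3) * Real.cos (σ 0) + β * (m 2 * Real.sin (σ 2) ^ 3) ∧
      β * (m 0 * Real.sin (σ 0) ^ 3) * height m σ 0 +
        β * (m 1 * Real.sin (σ 1) ^ 3) * height m σ 1 +
        β * (m 2 * Real.sin (σ 2) ^ 3) * height m σ 2 = 1 := by
  obtain ⟨l, hl, hrow⟩ := h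
  have hW := weight_pos hm hσ
  have hk2 : √(eigen m σ / weight m σ) ^ 2 = l / weight m σ := by
    rw [eigen_eq hσ hrow, Real.sq_sqrt (by positivity)]
  have hk0 : 0 < √(eigen m σ / weight m σ) := by
    rw [eigen_eq hσ hrow]; positivity
  have hW' : weight m σ = m 0 * Real.sin (σ 0) ^ 6 + m 1 * Real.sin (σ 1) ^ 6
      + m 2 * Real.sin (σ 2) ^ 6 := Fin.sum_univ_three _
  unfold height
  generalize √(eigen m σ / weight m σ) = k at *
  have h0 := hrow 0
  have h1 := hrow 1
  have h2 := hrow 2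
  simp only [row, Fin.isValue, Fin.reduceAdd, zero_add] at h0 h1 h2
  refine ⟨k / l, by positivity, ?_, ?_, ?_, ?_⟩
  · field_simp
    linear_combination -h0
  · field_simp
    linear_combination -h1
  · field_simp
    linear_combination -h2
  · field_simp at hk2 ⊢
    rw [hW'] at hk2
    linear_combination hk2

theorem radius_sq (h : 0 < 1 - height m σ 0 ^ 2) : radius m σ ^ 2 = 1 - height m σ 0 ^ 2 :=
  Real.sq_sqrt h.le

/-- The square root in `ordinate` is that of a multiple of the Gram determinant by a positive
factor. -/
theorem ordinate_sq (hm : ∀ k, 0 < m k) (hσ : σ ∈ U) (h : IsLagrangeShape m σ)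
    (hr : 0 < 1 - height m σ 0 ^ 2) (hG : 0 ≤ gramDet σ) :
    ordinate m σ ^ 2 = 1 - height m σ 1 ^ 2 - abscissa m σ ^ 2 ∧
      (gramDet σ = 0 ↔ ordinate m σ = 0) := by
  obtain ⟨β, hβ, h0, h1, h2, h3⟩ := height_facts hm hσ h
  have key := gram_minor_projected h0 h1 h2 h3
  have hr2 := radius_sq hr
  have hr0 : 0 < radius m σ := Real.sqrt_pos.2 hr
  have hB : 1 - height m σ 1 ^ 2 - abscissa m σ ^ 2 =
      (β * (m 2 * Real.sin (σ 2) ^ 3)) ^ 2 * gramDet σ / (1 - height m σ 0 ^ 2) := by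
    rw [gramDet, ← key, abscissa, div_pow, hr2]
    field_simp
  have hc : 0 < (β * (m 2 * Real.sin (σ 2) ^ 3)) ^ 2 := by
    have := sin_pos_of_mem_U hσ 2
    have := hm 2
    positivity
  have hnn : 0 ≤ 1 - height m σ 1 ^ 2 - abscissa m σ ^ 2 := by
    rw [hB]; positivity
  refine ⟨Real.sq_sqrt hnn, ?_⟩
  rw [ordinate, Real.sqrt_eq_zero hnn, hB, div_eq_zero_iff, or_iff_left hr.ne', mul_eq_zero,
    or_iff_right hc.ne']

/-- For either sign of the square root `y`, the configuration `config m σ y` is a relative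
equilibrium of shape `σ`; its orientation has the sign of `y`. -/
theorem config_spec (hm : ∀ k, 0 < m k) (hσ : σ ∈ U) (h : IsLagrangeShape m σ)
    (hr : 0 < 1 - height m σ 0 ^ 2) {y : ℝ}
    (hy : y ^ 2 = 1 - height m σ 1 ^ 2 - abscissa m σ ^ 2) :
    shape (config m σ y) = σ ∧ IsRE m (config m σ y) ∧
      ∃ b, 0 < b ∧ orientation (config m σ y) = b * y := by
  obtain ⟨β, hβ, h0, h1, h2, h3⟩ := height_facts hm hσ h
  obtain ⟨l, hl, hrow⟩ := h
  have hr2 := radius_sq hr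
  have hr0 : 0 < radius m σ := Real.sqrt_pos.2 hr
  have hs := sin_pos_of_mem_U hσ
  have ha : radius m σ * abscissa m σ = Real.cos (σ 2) - height m σ 0 * height m σ 1 := by
    rw [abscissa]; field_simp
  have Y0 : 0 < m 0 * Real.sin (σ 0) ^ 3 := mul_pos (hm 0) (pow_pos (hs 0) 3)
  have Y1 : 0 < m 1 * Real.sin (σ 1) ^ 3 := mul_pos (hm 1) (pow_pos (hs 1) 3)
  have Y2 : 0 < m 2 * Real.sin (σ 2) ^ 3 := mul_pos (hm 2) (pow_pos (hs 2) 3)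
  simp only [config]
  set z0 := height m σ 0
  set z1 := height m σ 1
  set z2 := height m σ 2
  set r := radius m σ
  set e := abscissa m σ
  set y0 := m 0 * Real.sin (σ 0) ^ 3 with hy0
  set y1 := m 1 * Real.sin (σ 1) ^ 3 with hy1
  set y2 := m 2 * Real.sin (σ 2) ^ 3 with hy2
  set c0 := Real.cos (σ 0) with hc0
  set c1 := Real.cos (σ 1) with hc1
  set c2 := Real.cos (σ 2) with hc2
  clear_value z0 z1 z2 r e y0 y1 y2 c0 c1 c2
  have hz : y0 * z0 + y1 * z1 + y2 * z2 = 1 / β := by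
    field_simp
    linear_combination h3
  -- the projected Gram matrix annihilates the vector of the `m j * x j`
  have k0 : y0 * (1 - z0 ^ 2) + y1 * (c2 - z0 * z1) + y2 * (c1 - z0 * z2) = 0 := by
    have : y0 + y1 * c2 + y2 * c1 = z0 * (1 / β) := by rw [h0]; field_simp
    linear_combination this - z0 * hz
  have k1 : y0 * (c2 - z0 * z1) + y1 * (1 - z1 ^ 2) + y2 * (c0 - z1 * z2) = 0 := by
    have : y0 * c2 + y1 + y2 * c0 = z1 * (1 / β) := by rw [h1]; field_simp
    linear_combination this - z1 * hz
  have k2 : y0 * (c1 - z0 * z2) + y1 * (c0 - z1 * z2) + y2 * (1 - z2 ^ 2) = 0 := by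
    have : y0 * c1 + y1 * c0 + y2 = z2 * (1 / β) := by rw [h2]; field_simp
    linear_combination this - z2 * hz
  have g22 : (-(y0 * r + y1 * e) / y2) ^ 2 + (-(y1 * y) / y2) ^ 2 + z2 ^ 2 = 1 := by
    field_simp
    linear_combination y1 ^ 2 * hy + y0 ^ 2 * hr2 + 2 * y0 * y1 * ha + y0 * k0 + y1 * k1 - y2 * k2
  have g02 : r * (-(y0 * r + y1 * e) / y2) + z0 * z2 = c1 := by
    field_simp
    linear_combination -y0 * hr2 - y1 * ha - k0
  have g12 : e * (-(y0 * r + y1 * e) / y2) + y * (-(y1 * y) / y2) + z1 * z2 = c0 := by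
    field_simp
    linear_combination -y0 * ha - y1 * hy - k1
  have hn : ∀ i, ‖(![!₂[r, 0, z0], !₂[e, y, z1], !₂[-(y0 * r + y1 * e) / y2,
      -(y1 * y) / y2, z2]] : Config) i‖ = 1 := by
    intro i
    rw [← sq_eq_sq₀ (norm_nonneg _) zero_le_one, norm_sq_eq_sum, one_pow]
    fin_cases i
    · simp
      linear_combination hr2
    · simp
      linear_combination hy
    · simpa using g22
  have hin : ∀ k, inner ℝ ((![!₂[r, 0, z0], !₂[e, y, z1], !₂[-(y0 * r + y1 * e) / y2,
      -(y1 * y) / y2, z2]] : Config) (k + 1)) ((![!₂[r, 0, z0], !₂[e, y, z1],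
      !₂[-(y0 * r + y1 * e) / y2, -(y1 * y) / y2, z2]] : Config) (k + 2)) =
      Real.cos (σ k) := by
    intro k
    rw [inner_eq_sum]
    fin_cases k
    · simp [← hc0]
      linear_combination g12
    · simp [← hc1]
      linear_combination g02
    · simp [← hc2]
      linear_combination ha
  refine ⟨(shape_eq_iff hn hσ).2 hin, isRE_of_isLagrangeShape hm hσ hn hin hrow (β := β) ?_,
    r / (β * y2), by positivity, ?_⟩
  · ext k
    have p := Y2.ne'
    rw [Fin.sum_univ_three, ← hy0, ← hy1, ← hy2]
    fin_cases k
    · simp [axis]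
      field_simp
      ring
    · simp [axis]
      field_simp
      ring
    · simp [axis]
      linear_combination -h3
  · rw [orientation, Matrix.det_fin_three]
    simp
    field_simp
    linear_combination (r * y) * h3
end

/-! ### The mirror pair of families along an arc -/

section continuity
variable {m : Fin 3 → ℝ} {X : Type*} [TopologicalSpace X] {S : Set X} {f : X → Shape}

theorem continuousOn_height (hm : ∀ k, 0 < m k) (hf : ContinuousOn f S) (hU : ∀ t ∈ S, f t ∈ U)
    (i : Fin 3) : ContinuousOn (fun t => height m (f t) i) S := by
  have hf' : ∀ k, ContinuousOn (fun t => f t k) S := fun k =>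
    (continuous_apply k).comp_continuousOn hf
  unfold height eigen weight row
  simp only [Fin.sum_univ_three]
  have h1 : ∀ t ∈ S, Real.sin (f t 2) ^ 3 ≠ 0 := fun t ht =>
    (pow_pos (sin_pos_of_mem_U (hU t ht) 2) 3).ne'
  have h2 : ∀ t ∈ S, m 0 * Real.sin (f t 0) ^ 6 + m 1 * Real.sin (f t 1) ^ 6 +
      m 2 * Real.sin (f t 2) ^ 6 ≠ 0 := fun t ht => by
    have := weight_pos hm (hU t ht)
    rw [weight, Fin.sum_univ_three] at this
    exact this.ne'
  have hs : ∀ k, ContinuousOn (fun t => Real.sin (f t k)) S := fun k =>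
    Real.continuous_sin.comp_continuousOn (hf' k)
  have hc : ∀ k, ContinuousOn (fun t => Real.cos (f t k)) S := fun k =>
    Real.continuous_cos.comp_continuousOn (hf' k)
  fun_prop (disch := assumption)

theorem continuousOn_radius (hm : ∀ k, 0 < m k) (hf : ContinuousOn f S) (hU : ∀ t ∈ S, f t ∈ U) :
    ContinuousOn (fun t => radius m (f t)) S :=
  (continuousOn_const.sub ((continuousOn_height hm hf hU 0).pow 2)).sqrt

theorem continuousOn_abscissa (hm : ∀ k, 0 < m k) (hf : ContinuousOn f S) (hU : ∀ t ∈ S, f t ∈ U)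
    (hr : ∀ t ∈ S, 0 < 1 - height m (f t) 0 ^ 2) :
    ContinuousOn (fun t => abscissa m (f t)) S :=
  ((Real.continuous_cos.comp_continuousOn ((continuous_apply 2).comp_continuousOn hf)).sub
    ((continuousOn_height hm hf hU 0).mul (continuousOn_height hm hf hU 1))).div
    (continuousOn_radius hm hf hU) fun t ht => (Real.sqrt_pos.2 (hr t ht)).ne'

theorem continuousOn_ordinate (hm : ∀ k, 0 < m k) (hf : ContinuousOn f S) (hU : ∀ t ∈ S, f t ∈ U)
    (hr : ∀ t ∈ S, 0 < 1 - height m (f t) 0 ^ 2) :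
    ContinuousOn (fun t => ordinate m (f t)) S :=
  ((continuousOn_const.sub ((continuousOn_height hm hf hU 1).pow 2)).sub
    ((continuousOn_abscissa hm hf hU hr).pow 2)).sqrt

theorem continuousOn_config (hm : ∀ k, 0 < m k) (hf : ContinuousOn f S) (hU : ∀ t ∈ S, f t ∈ U)
    (hr : ∀ t ∈ S, 0 < 1 - height m (f t) 0 ^ 2) {y : X → ℝ} (hy : ContinuousOn y S) :
    ContinuousOn (fun t => config m (f t) (y t)) S := by
  have h0 := continuousOn_height hm hf hU 0
  have h1 := continuousOn_height hm hf hU 1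
  have h2 := continuousOn_height hm hf hU 2
  have h3 := continuousOn_radius hm hf hU
  have h4 := continuousOn_abscissa hm hf hU hr
  have hf' : ∀ k, ContinuousOn (fun t => f t k) S := fun k =>
    (continuous_apply k).comp_continuousOn hf
  have hs : ∀ k, ContinuousOn (fun t => Real.sin (f t k)) S := fun k =>
    Real.continuous_sin.comp_continuousOn (hf' k)
  have hne : ∀ t ∈ S, m 2 * Real.sin (f t 2) ^ 3 ≠ 0 := fun t ht =>
    (mul_pos (hm 2) (pow_pos (sin_pos_of_mem_U (hU t ht) 2) 3)).ne'
  have vec : ∀ a b c : X → ℝ, ContinuousOn a S → ContinuousOn b S → ContinuousOn c S →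
      ContinuousOn (fun t => (!₂[a t, b t, c t] : E3)) S := by
    intro a b c ha hb hc
    refine (PiLp.continuous_toLp 2 _).comp_continuousOn (continuousOn_pi.2 fun k => ?_)
    fin_cases k <;> assumption
  refine continuousOn_pi.2 fun k => ?_
  have e2 : ContinuousOn (fun t => -(m 0 * Real.sin (f t 0) ^ 3 * radius m (f t) +
      m 1 * Real.sin (f t 1) ^ 3 * abscissa m (f t)) / (m 2 * Real.sin (f t 2) ^ 3)) S := by
    fun_prop (disch := assumption)
  have e3 : ContinuousOn (fun t => -(m 1 * Real.sin (f t 1) ^ 3 * y t) /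
      (m 2 * Real.sin (f t 2) ^ 3)) S := by
    fun_prop (disch := assumption)
  fin_cases k
  · exact vec _ _ _ h3 continuousOn_const h0
  · exact vec _ _ _ h4 hy h1
  · exact vec _ _ _ e2 e3 h2

end continuity

theorem isOpen_U : IsOpen U := by
  have : U = ⋂ k : Fin 3, {σ : Shape | 0 < σ k ∧ σ k < Real.pi} := by
    ext σ; simp [U]
  rw [this]
  exact isOpen_iInter_of_finite fun k =>
    (isOpen_lt continuous_const (continuous_apply k)).inter
      (isOpen_lt (continuous_apply k) continuous_const)

theorem IsRegularArc.continuousOn {p : Shape} {ε : ℝ} {γ : ℝ → Shape} (h : IsRegularArc p ε γ) :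
    ContinuousOn γ (Ioo (-ε) ε) := h.2.2.1.continuousOn

theorem IsRegularArc.mono {p : Shape} {ε ε' : ℝ} {γ : ℝ → Shape} (h : IsRegularArc p ε γ)
    (h0 : 0 < ε') (hle : ε' ≤ ε) : IsRegularArc p ε' γ := by
  have hsub : Ioo (-ε') ε' ⊆ Ioo (-ε) ε := Ioo_subset_Ioo (by linarith) hle
  exact ⟨h0, h.2.1, h.2.2.1.mono hsub, fun t ht => h.2.2.2 t (hsub ht)⟩

/-- A property that holds near the base point of an arc holds along a shorter arc. -/
theorem IsRegularArc.exists_shorter {p : Shape} {ε : ℝ} {γ : ℝ → Shape} (h : IsRegularArc p ε γ)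
    {P : Shape → Prop} (hP : ∀ᶠ σ in nhds p, P σ) :
    ∃ δ, 0 < δ ∧ δ ≤ ε ∧ ∀ t ∈ Ioo (-δ) δ, P (γ t) := by
  have hc : ContinuousAt γ 0 := h.continuousOn.continuousAt (Ioo_mem_nhds (by linarith [h.1]) h.1)
  have h1 : ∀ᶠ t in nhds (0 : ℝ), P (γ t) := by
    rw [ContinuousAt, h.2.1] at hc
    exact hc.eventually hP
  obtain ⟨δ, hδ, hb⟩ := Metric.eventually_nhds_iff.1 h1
  refine ⟨min δ ε, lt_min hδ h.1, min_le_right _ _, fun t ht => hb ?_⟩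
  rw [Real.dist_0_eq_abs, abs_lt]
  exact ⟨by linarith [ht.1, min_le_left δ ε], by linarith [ht.2, min_le_left δ ε]⟩

/-- The two families of mirror images of the configurations along a half arc of Lagrange shapes
join at the meridian configuration in which the arc starts. -/
theorem hasLRECoupling_of_arc {m : Fin 3 → ℝ} (hm : ∀ k, 0 < m k) {p : Shape} (hp : p ∈ U)
    (hL : IsLagrangeShape m p) (hr : 0 < 1 - height m p 0 ^ 2) (hG : gramDet p = 0)
    {ε : ℝ} {γ : ℝ → Shape} (hγ : IsRegularArc p ε γ)
    (h : ∀ t ∈ Ioo 0 ε, IsLagrangeShape m (γ t) ∧ 0 < gramDet (γ t)) : HasLRECoupling m p := by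
  have hUn : U ∈ nhds p := isOpen_U.mem_nhds hp
  have hev : ∀ᶠ σ in nhds p, 0 < 1 - height m σ 0 ^ 2 := by
    have hc : ContinuousAt (fun σ : Shape => height m σ 0) p :=
      (continuousOn_height (f := fun σ => σ) hm continuousOn_id (fun σ hσ => hσ) 0).continuousAt hUn
    exact (continuousAt_const.sub (hc.pow 2)).eventually (lt_mem_nhds hr)
  obtain ⟨δ, hδ, hle, hδP⟩ := hγ.exists_shorter (hev.and hUn)
  have harc := hγ.mono hδ hle
  have habs : ∀ t ∈ Ioo (-δ) δ, |t| ∈ Ioo (-δ) δ := fun t ht =>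
    ⟨by linarith [abs_nonneg t], abs_lt.2 ht⟩
  have hpos : ∀ t ∈ Ioo (-δ) δ, max t 0 ∈ Ioo (-δ) δ := fun t ht =>
    ⟨lt_max_of_lt_left ht.1, max_lt ht.2 hδ⟩
  have hneg : ∀ t ∈ Ioo (-δ) δ, -t ∈ Ioo (-δ) δ := fun t ht =>
    ⟨by linarith [ht.2], by linarith [ht.1]⟩
  have hO : ContinuousOn (fun t => ordinate m (γ t)) (Ioo (-δ) δ) :=
    continuousOn_ordinate hm harc.continuousOn (fun t ht => (hδP t ht).2) fun t ht => (hδP t ht).1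
  have hO0 : ordinate m (γ 0) = 0 := by
    rw [hγ.2.1]
    exact (ordinate_sq hm hp hL hr hG.ge).2.1 hG
  have hO2 : ∀ t ∈ Ioo 0 δ, 0 < ordinate m (γ t) ∧
      ordinate m (γ t) ^ 2 = 1 - height m (γ t) 1 ^ 2 - abscissa m (γ t) ^ 2 := by
    intro t ht
    have ht' : t ∈ Ioo (-δ) δ := ⟨by linarith [ht.1], ht.2⟩
    obtain ⟨hLt, hGt⟩ := h t ⟨ht.1, ht.2.trans_le hle⟩
    have := ordinate_sq hm (hδP t ht').2 hLt (hδP t ht').1 hGt.le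
    refine ⟨lt_of_le_of_ne (Real.sqrt_nonneg _) fun h0 => hGt.ne' (this.2.2 h0.symm), this.1⟩
  -- the ordinate with a sign: at most one of the two terms is not zero
  let y : ℝ → ℝ := fun t => ordinate m (γ (max t 0)) - ordinate m (γ (max (-t) 0))
  have hy1 : ∀ t, 0 < t → y t = ordinate m (γ t) := fun t ht => by
    simp only [y]
    rw [max_eq_left ht.le, max_eq_right (by linarith), hO0, sub_zero]
  have hy2 : ∀ t, t < 0 → y t = -ordinate m (γ (-t)) := fun t ht => by
    simp only [y]
    rw [max_eq_right ht.le, max_eq_left (by linarith), hO0, zero_sub]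
  have hy0 : y 0 = 0 := by simp [y]
  have hycont : ContinuousOn y (Ioo (-δ) δ) := by
    refine (hO.comp (continuous_id.max continuous_const).continuousOn hpos).sub
      (hO.comp (continuous_neg.max continuous_const).continuousOn fun t ht => ?_)
    exact hpos _ (hneg t ht)
  have p0 := config_spec hm hp hL hr (y := 0) (by
    rw [← (ordinate_sq hm hp hL hr hG.ge).1, (ordinate_sq hm hp hL hr hG.ge).2.1 hG])
  have main : ∀ t ∈ Ioo 0 δ, ∀ Y, Y ^ 2 = ordinate m (γ t) ^ 2 →
      shape (config m (γ t) Y) = γ t ∧ IsLRE m (config m (γ t) Y) ∧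
        ∃ b, 0 < b ∧ orientation (config m (γ t) Y) = b * Y := by
    intro t ht Y hY
    have ht' : t ∈ Ioo (-δ) δ := ⟨by linarith [ht.1], ht.2⟩
    obtain ⟨hLt, hGt⟩ := h t ⟨ht.1, ht.2.trans_le hle⟩
    have hq := config_spec hm (hδP t ht').2 hLt (hδP t ht').1 (hY.trans (hO2 t ht).2)
    refine ⟨hq.1, ⟨hq.2.1, ?_⟩, hq.2.2⟩
    obtain ⟨b, hb, hor⟩ := hq.2.2
    rw [not_onGeodesic_iff, hor]
    refine mul_ne_zero hb.ne' fun h0 => ?_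
    have := (hO2 t ht).1
    rw [h0] at hY
    nlinarith
  refine ⟨δ, γ, fun t => config m (γ |t|) (y t), harc, ?_, ?_, ?_, ?_, ?_⟩
  · exact continuousOn_config hm (harc.continuousOn.comp continuous_abs.continuousOn habs)
      (fun t ht => (hδP _ (habs t ht)).2) (fun t ht => (hδP _ (habs t ht)).1) hycont
  · intro t ht
    rcases lt_trichotomy t 0 with h0 | h0 | h0
    · have ht' : |t| ∈ Ioo 0 δ := ⟨abs_pos.2 h0.ne, (habs t ht).2⟩
      refine (main _ ht' _ ?_).1
      rw [hy2 t h0, abs_of_neg h0]; ring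
    · subst h0
      simp only [abs_zero, hγ.2.1, hy0]
      exact p0.1
    · have ht' : |t| ∈ Ioo 0 δ := ⟨abs_pos.2 h0.ne', (habs t ht).2⟩
      refine (main _ ht' _ ?_).1
      rw [hy1 t h0, abs_of_pos h0]
  · simp only [abs_zero, hγ.2.1, hy0]
    refine ⟨p0.2.1, !₂[0, 1, 0], fun h0 => ?_, ?_, fun i => ?_⟩
    · simpa using congrArg (fun u : E3 => u 1) h0
    · simp [inner_eq_sum, axis]
    · rw [inner_eq_sum, config]
      fin_cases i <;> simp
  · intro t ht
    have ht' : -t ∈ Ioo 0 δ := ⟨by linarith [ht.2], by linarith [ht.1]⟩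
    simp only [abs_of_neg ht.2, hy2 t ht.2]
    obtain ⟨-, h2, b, hb, h3⟩ := main _ ht' (-ordinate m (γ (-t))) (by ring)
    refine ⟨h2, ?_⟩
    rw [h3]
    nlinarith [mul_pos hb (hO2 _ ht').1]
  · intro t ht
    simp only [abs_of_pos ht.1, hy1 t ht.1]
    obtain ⟨-, h2, b, hb, h3⟩ := main _ ht (ordinate m (γ t)) rfl
    refine ⟨h2, ?_⟩
    rw [h3]
    exact mul_pos hb (hO2 _ ht).1

/-! ### Arcs from the implicit function theorem -/

/-- The implicit function theorem for a curve given by two equations in the shape space: if `ℓ`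
does not vanish on the common kernel of the derivatives, then the solutions near `p` form a regular
arc on which `ℓ` is a parameter. -/
theorem exists_regularArc {f₁ f₂ : Shape → ℝ} {f₁' f₂' : Shape →L[ℝ] ℝ} {p : Shape}
    (ℓ : Shape →L[ℝ] ℝ) (h₁ : ContDiffAt ℝ 1 f₁ p) (h₂ : ContDiffAt ℝ 1 f₂ p)
    (h₁' : HasFDerivAt f₁ f₁' p) (h₂' : HasFDerivAt f₂ f₂' p) (hp₁ : f₁ p = 0) (hp₂ : f₂ p = 0)
    (hinj : ∀ v, f₁' v = 0 → f₂' v = 0 → ℓ v = 0 → v = 0) :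
    ∃ ε γ, IsRegularArc p ε γ ∧
      (∀ t ∈ Ioo (-ε) ε, f₁ (γ t) = 0 ∧ f₂ (γ t) = 0 ∧ ℓ (γ t - p) = t) ∧
      ∀ᶠ σ in nhds p, f₁ σ = 0 → f₂ σ = 0 → |ℓ (σ - p)| < ε ∧ γ (ℓ (σ - p)) = σ := by
  let Φ : Shape → Shape := fun σ => ![f₁ σ, f₂ σ, ℓ (σ - p)]
  let L : Shape →L[ℝ] Shape := ContinuousLinearMap.pi ![f₁', f₂', ℓ]
  have hℓ' : HasFDerivAt (fun σ => ℓ (σ - p)) ℓ p := by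
    have h0 : HasFDerivAt (fun σ : Shape => σ - p) (ContinuousLinearMap.id ℝ Shape) p :=
      (hasFDerivAt_id p).sub_const p
    have h := HasFDerivAt.comp (f := fun σ : Shape => σ - p) p (ℓ.hasFDerivAt (x := p - p)) h0
    rw [ContinuousLinearMap.comp_id] at h
    exact h
  have hLinj : Function.Injective (L : Shape →ₗ[ℝ] Shape) := by
    rw [← LinearMap.ker_eq_bot, LinearMap.ker_eq_bot']
    intro v hv
    exact hinj v (congrFun hv 0) (congrFun hv 1) (congrFun hv 2)
  let e : Shape ≃L[ℝ] Shape := (LinearEquiv.ofInjectiveEndo _ hLinj).toContinuousLinearEquiv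
  have he : (e : Shape →L[ℝ] Shape) = L := by
    ext v; rfl
  have hΦ' : HasFDerivAt Φ (e : Shape →L[ℝ] Shape) p := by
    rw [he, hasFDerivAt_pi']
    intro k
    fin_cases k
    · exact h₁'
    · exact h₂'
    · exact hℓ'
  have hΦ : ContDiffAt ℝ 1 Φ p := by
    rw [contDiffAt_pi]
    intro k
    fin_cases k
    · exact h₁
    · exact h₂
    · exact ℓ.contDiff.contDiffAt.comp p (contDiffAt_id.sub contDiffAt_const)
  have hstrict := hΦ.hasStrictFDerivAt' hΦ' one_ne_zero
  have hΦp : Φ p = 0 := by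
    ext k
    fin_cases k <;> simp [Φ, hp₁, hp₂]
  let g := hΦ.localInverse hΦ' one_ne_zero
  have hg0 : g 0 = p := by
    rw [← hΦp]
    exact hΦ.localInverse_apply_image hΦ' one_ne_zero
  have hg : ContDiffAt ℝ 1 g 0 := by
    rw [← hΦp]
    exact hΦ.to_localInverse hΦ' one_ne_zero
  have hright : ∀ᶠ y in nhds 0, Φ (g y) = y := by
    rw [← hΦp]
    exact hstrict.eventually_right_inverse
  have hleft : ∀ᶠ σ in nhds p, g (Φ σ) = σ := hstrict.eventually_left_inverse
  -- the arc is the preimage of the third coordinate axis under the local diffeomorphism `Φ`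
  let ι : ℝ → Shape := fun t => ![0, 0, t]
  have hι0 : ι 0 = 0 := by
    ext k
    fin_cases k <;> simp [ι]
  have hι : ContDiff ℝ 1 ι := by
    rw [contDiff_pi]
    intro k
    fin_cases k
    · exact contDiff_const
    · exact contDiff_const
    · exact contDiff_id
  have hιt : Filter.Tendsto ι (nhds 0) (nhds 0) := by
    simpa [hι0] using hι.continuous.tendsto 0
  have hev : ∀ᶠ t in nhds (0 : ℝ), ContDiffAt ℝ 1 g (ι t) ∧ Φ (g (ι t)) = ι t :=
    hιt.eventually ((hg.eventually (by simp)).and hright)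
  obtain ⟨ε, hε, hb⟩ := Metric.eventually_nhds_iff.1 hev
  have hb' : ∀ t ∈ Ioo (-ε) ε, ContDiffAt ℝ 1 g (ι t) ∧ Φ (g (ι t)) = ι t := fun t ht =>
    hb (by rw [Real.dist_0_eq_abs, abs_lt]; exact ht)
  have hγ : ∀ t ∈ Ioo (-ε) ε, ContDiffAt ℝ 1 (fun t => g (ι t)) t := fun t ht =>
    (hb' t ht).1.comp t hι.contDiffAt
  have hℓγ : ∀ t ∈ Ioo (-ε) ε, ℓ (g (ι t) - p) = t := fun t ht => congrFun (hb' t ht).2 2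
  refine ⟨ε, fun t => g (ι t), ⟨hε, by simp only [hι0, hg0], fun t ht =>
    (hγ t ht).contDiffWithinAt, fun t ht h0 => ?_⟩, fun t ht =>
    ⟨congrFun (hb' t ht).2 0, congrFun (hb' t ht).2 1, hℓγ t ht⟩, ?_⟩
  · have hd : HasDerivAt (fun t => g (ι t)) 0 t := by
      rw [← h0]
      exact ((hγ t ht).differentiableAt one_ne_zero).hasDerivAt
    have h1 : HasDerivAt (fun t => ℓ (g (ι t) - p)) (ℓ 0) t :=
      ℓ.hasFDerivAt.comp_hasDerivAt t (hd.sub_const p)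
    have h2 : HasDerivAt (fun t => ℓ (g (ι t) - p)) 1 t :=
      (hasDerivAt_id t).congr_of_eventuallyEq
        (Filter.eventually_of_mem (Ioo_mem_nhds ht.1 ht.2) hℓγ)
    simpa using h1.unique h2
  · have hsmall : ∀ᶠ σ in nhds p, |ℓ (σ - p)| < ε := by
      have hc : Continuous fun σ : Shape => |ℓ (σ - p)| := by fun_prop
      exact hc.continuousAt.eventually (gt_mem_nhds (by simpa using hε))
    filter_upwards [hleft, hsmall] with σ h1 h2 h3 h4
    refine ⟨h2, ?_⟩
    have : ι (ℓ (σ - p)) = Φ σ := by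
      simp only [ι, Φ, h3, h4]
    rw [this, h1]

/-- Running through an arc backwards. -/
theorem IsRegularArc.reverse {p : Shape} {ε : ℝ} {γ : ℝ → Shape} (h : IsRegularArc p ε γ) :
    IsRegularArc p ε fun t => γ (-t) := by
  have hneg : ∀ t ∈ Ioo (-ε) ε, -t ∈ Ioo (-ε) ε := fun t ht =>
    ⟨by linarith [ht.2], by linarith [ht.1]⟩
  refine ⟨h.1, by simpa using h.2.1, h.2.2.1.comp contDiff_neg.contDiffOn hneg, fun t ht => ?_⟩
  rw [deriv_comp_neg]
  exact neg_ne_zero.2 (h.2.2.2 _ (hneg t ht))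

/-- If a continuous path of points of a set `S` reaches the base point `p ∉ S` of an arc, and the
arc contains all points of `S` near `p`, then one of the two halves of the arc is in `S` near `p`.
The parameter of the path along the arc does not vanish after the start, so that it runs through an
interval. -/
theorem exists_half_arc {p : Shape} {ε : ℝ} {γ Γ : ℝ → Shape} {S : Set Shape}
    (ℓ : Shape →L[ℝ] ℝ) (hγ : IsRegularArc p ε γ)
    (hloc : ∀ᶠ σ in nhds p, σ ∈ S → |ℓ (σ - p)| < ε ∧ γ (ℓ (σ - p)) = σ) (hp : p ∉ S)
    (hΓ : ContinuousOn Γ (Icc 0 1)) (hΓ0 : Γ 0 = p) (hΓS : ∀ t ∈ Ioc 0 1, Γ t ∈ S) :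
    ∃ δ γ', IsRegularArc p δ γ' ∧ ∀ t ∈ Ioo 0 δ, γ' t ∈ S := by
  have h1 : ∀ᶠ t in nhdsWithin (0 : ℝ) (Icc 0 1),
      Γ t ∈ S → |ℓ (Γ t - p)| < ε ∧ γ (ℓ (Γ t - p)) = Γ t := by
    have hc : Filter.Tendsto Γ (nhdsWithin 0 (Icc 0 1)) (nhds p) := by
      have := hΓ 0 (by simp)
      rwa [ContinuousWithinAt, hΓ0] at this
    exact hc.eventually hloc
  rw [eventually_nhdsWithin_iff, Metric.eventually_nhds_iff] at h1
  obtain ⟨η, hη, hb⟩ := h1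
  set T := min (η / 2) 1 with hT
  have hT0 : 0 < T := by positivity
  have hT1 : T ≤ 1 := min_le_right _ _
  have hTη : T < η := lt_of_le_of_lt (min_le_left _ _) (by linarith)
  have hb' : ∀ t ∈ Ioc 0 T, Γ t ∈ S ∧ |ℓ (Γ t - p)| < ε ∧ γ (ℓ (Γ t - p)) = Γ t := by
    intro t ht
    have hS := hΓS t ⟨ht.1, ht.2.trans hT1⟩
    refine ⟨hS, hb ?_ ⟨ht.1.le, ht.2.trans hT1⟩ hS⟩
    rw [Real.dist_0_eq_abs, abs_of_pos ht.1]
    exact ht.2.trans_lt hTη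
  let ψ : ℝ → ℝ := fun t => ℓ (Γ t - p)
  have hψ : ContinuousOn ψ (Icc 0 T) :=
    ℓ.continuous.comp_continuousOn ((hΓ.mono (Icc_subset_Icc_right hT1)).sub continuousOn_const)
  have hψ0 : ψ 0 = 0 := by simp [ψ, hΓ0]
  have hψT : ψ T ≠ 0 := by
    intro h0
    obtain ⟨hS, -, h2⟩ := hb' T ⟨hT0, le_rfl⟩
    change γ (ψ T) = Γ T at h2
    rw [h0, hγ.2.1] at h2
    exact hp (h2 ▸ hS)
  have hlt : |ψ T| < ε := (hb' T ⟨hT0, le_rfl⟩).2.1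
  have hall : ∀ s ∈ ψ '' Icc 0 T, s ≠ 0 → γ s ∈ S := by
    rintro s ⟨t, ht, rfl⟩ hs
    have ht0 : t ≠ 0 := by
      rintro rfl
      exact hs hψ0
    obtain ⟨hS, -, h2⟩ := hb' t ⟨lt_of_le_of_ne ht.1 ht0.symm, ht.2⟩
    change γ (ψ t) = Γ t at h2
    rwa [h2]
  rcases lt_or_gt_of_ne hψT with h0 | h0
  · refine ⟨|ψ T|, fun t => γ (-t), hγ.reverse.mono (abs_pos.2 hψT) hlt.le, fun t ht => ?_⟩
    refine hall (-t) (intermediate_value_Icc' hT0.le hψ ?_) (by linarith [ht.1] : -t < 0).ne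
    rw [hψ0]
    rw [abs_of_neg h0] at ht
    exact ⟨by linarith [ht.2], by linarith [ht.1]⟩
  · refine ⟨|ψ T|, γ, hγ.mono (abs_pos.2 hψT) hlt.le, fun t ht => ?_⟩
    refine hall t (intermediate_value_Icc hT0.le hψ ?_) ht.1.ne'
    rw [hψ0]
    rw [abs_of_pos h0] at ht
    exact ⟨ht.1.le, ht.2.le⟩

/-! ### The curve on the plane -/

/-- The data of a point of the curve `h = 0`: in the plane triangle with the angles `σ₁`, `σ₂`,
`π - σ₃` the sides are proportional to `u`, `v`, `1`. The curve is parametrized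
by `w = u² + v² - 1` and `d = u² - v²`, which satisfy one relation. -/
structure CurveData (p : Shape) (u v s w d : ℝ) : Prop where
  u_pos : 0 < u
  v_pos : 0 < v
  s_pos : 0 < s
  w_pos : 0 < w
  u_sq : u ^ 2 = (1 + w + d) / 2
  v_sq : v ^ 2 = (1 + w - d) / 2
  d_sq : d ^ 2 = 1 - 2 * w - w ^ 2
  s_sq : 2 * (w + 2) * s ^ 2 = w + 4
  sin0 : Real.sin (p 0) = u * s
  sin1 : Real.sin (p 1) = v * s
  sin2 : Real.sin (p 2) = s
  cos0 : 2 * v * Real.cos (p 0) = 1 - d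
  cos1 : 2 * u * Real.cos (p 1) = 1 + d
  cos2 : 2 * u * v * Real.cos (p 2) = -w

theorem addition_formulas {p : Shape} (hp : p ∈ eulerPlane) :
    Real.sin (p 0) = Real.sin (p 2) * Real.cos (p 1) - Real.cos (p 2) * Real.sin (p 1) ∧
    Real.sin (p 1) = Real.sin (p 2) * Real.cos (p 0) - Real.cos (p 2) * Real.sin (p 0) ∧
    Real.sin (p 2) = Real.sin (p 0) * Real.cos (p 1) + Real.cos (p 0) * Real.sin (p 1) ∧
    Real.cos (p 0) = Real.cos (p 2) * Real.cos (p 1) + Real.sin (p 2) * Real.sin (p 1) ∧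
    Real.cos (p 1) = Real.cos (p 2) * Real.cos (p 0) + Real.sin (p 2) * Real.sin (p 0) ∧
    Real.cos (p 2) = Real.cos (p 0) * Real.cos (p 1) - Real.sin (p 0) * Real.sin (p 1) := by
  have h : p 2 = p 0 + p 1 := hp
  have h0 : p 0 = p 2 - p 1 := by linarith
  have h1 : p 1 = p 2 - p 0 := by linarith
  refine ⟨?_, ?_, ?_, ?_, ?_, ?_⟩
  · rw [← Real.sin_sub, ← h0]
  · rw [← Real.sin_sub, ← h1]
  · rw [← Real.sin_add, ← h]
  · rw [← Real.cos_sub, ← h0]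
  · rw [← Real.cos_sub, ← h1]
  · rw [← Real.cos_add, ← h]

/-- The law of cosines in the plane triangle with the angles `σ₁`, `σ₂`, `π - σ₃`, whose sides are
proportional to the sines. -/
theorem law_of_cosines {p : Shape} (hp : p ∈ eulerPlane) :
    2 * Real.sin (p 1) * Real.sin (p 2) * Real.cos (p 0) =
      Real.sin (p 1) ^ 2 + Real.sin (p 2) ^ 2 - Real.sin (p 0) ^ 2 ∧
    2 * Real.sin (p 0) * Real.sin (p 2) * Real.cos (p 1) =
      Real.sin (p 0) ^ 2 + Real.sin (p 2) ^ 2 - Real.sin (p 1) ^ 2 ∧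
    2 * Real.sin (p 0) * Real.sin (p 1) * Real.cos (p 2) =
      Real.sin (p 2) ^ 2 - Real.sin (p 0) ^ 2 - Real.sin (p 1) ^ 2 := by
  obtain ⟨h0, h1, h2, -⟩ := addition_formulas hp
  refine ⟨?_, ?_, ?_⟩
  · linear_combination Real.sin (p 0) * h0 - Real.sin (p 1) * h1 - Real.sin (p 2) * h2
  · linear_combination -Real.sin (p 0) * h0 + Real.sin (p 1) * h1 - Real.sin (p 2) * h2
  · linear_combination Real.sin (p 0) * h0 + Real.sin (p 1) * h1 - Real.sin (p 2) * h2

/-- On the plane `σ₃ = σ₁ + σ₂`, the equation `h = 0` says that `x` is orthogonal to the kernel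
`(sin σ₁, sin σ₂, - sin σ₃)` of the Gram matrix. -/
theorem h_eq_zero_iff {p : Shape} (hU : p ∈ U) (hp : p ∈ eulerPlane) :
    h p = 0 ↔ Real.sin (p 0) ^ 4 + Real.sin (p 1) ^ 4 = Real.sin (p 2) ^ 4 := by
  have hs := sin_pos_of_mem_U hU
  have key : Real.sin (p 0) * Real.sin (p 1) * h p =
      2 * (Real.sin (p 0) ^ 4 + Real.sin (p 1) ^ 4 - Real.sin (p 2) ^ 4) := by
    obtain ⟨-, -, h2, -, -, h5⟩ := addition_formulas hp
    have t0 := Real.sin_sq_add_cos_sq (p 0)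
    have t1 := Real.sin_sq_add_cos_sq (p 1)
    rw [h, Real.cos_three_mul, Real.cos_two_mul, Real.cos_sub, h5, h2]
    generalize Real.sin (p 0) = a at *
    generalize Real.sin (p 1) = b at *
    generalize Real.cos (p 0) = x at *
    generalize Real.cos (p 1) = y at *
    have hx : x ^ 2 = 1 - a ^ 2 := by linarith
    have hy : y ^ 2 = 1 - b ^ 2 := by linarith
    have hx3 : x ^ 3 = x * (1 - a ^ 2) := by rw [← hx]; ring
    have hy3 : y ^ 3 = y * (1 - b ^ 2) := by rw [← hy]; ring
    have hx4 : x ^ 4 = (1 - a ^ 2) ^ 2 := by rw [← hx]; ring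
    have hy4 : y ^ 4 = (1 - b ^ 2) ^ 2 := by rw [← hy]; ring
    ring_nf
    simp only [hx, hy, hx3, hy3, hx4, hy4]
    ring
  have hne : Real.sin (p 0) * Real.sin (p 1) ≠ 0 := (mul_pos (hs 0) (hs 1)).ne'
  constructor
  · intro h0
    rw [h0, mul_zero] at key
    linarith
  · intro h0
    refine (mul_eq_zero.1 ?_).resolve_left hne
    rw [key]
    linarith

theorem exists_curveData {p : Shape} (hU : p ∈ U) (hp : p ∈ eulerPlane)
    (hq : Real.sin (p 0) ^ 4 + Real.sin (p 1) ^ 4 = Real.sin (p 2) ^ 4) :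
    ∃ u v s w d, CurveData p u v s w d := by
  have h0 := sin_pos_of_mem_U hU 0
  have h1 := sin_pos_of_mem_U hU 1
  have h2 := sin_pos_of_mem_U hU 2
  obtain ⟨l0, l1, l2⟩ := law_of_cosines hp
  have t2 := Real.sin_sq_add_cos_sq (p 2)
  set s := Real.sin (p 2) with hs
  obtain ⟨u, hu⟩ : ∃ u, u = Real.sin (p 0) / s := ⟨_, rfl⟩
  obtain ⟨v, hv⟩ : ∃ v, v = Real.sin (p 1) / s := ⟨_, rfl⟩
  have eu : Real.sin (p 0) = u * s := by rw [hu]; field_simp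
  have ev : Real.sin (p 1) = v * s := by rw [hv]; field_simp
  have hu0 : 0 < u := by rw [hu]; positivity
  have hv0 : 0 < v := by rw [hv]; positivity
  rw [eu, ev] at hq l0 l1 l2
  have hs2 : s ^ 2 ≠ 0 := by positivity
  have hc : u ^ 4 + v ^ 4 = 1 := by
    refine mul_right_cancel₀ (pow_ne_zero 2 hs2) ?_
    linear_combination hq
  have l0' : 2 * v * Real.cos (p 0) = 1 - (u ^ 2 - v ^ 2) := by
    refine mul_right_cancel₀ hs2 ?_
    linear_combination l0
  have l1' : 2 * u * Real.cos (p 1) = 1 + (u ^ 2 - v ^ 2) := by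
    refine mul_right_cancel₀ hs2 ?_
    linear_combination l1
  have l2' : 2 * u * v * Real.cos (p 2) = -(u ^ 2 + v ^ 2 - 1) := by
    refine mul_right_cancel₀ hs2 ?_
    linear_combination l2
  have hw : 0 < u ^ 2 + v ^ 2 - 1 := by
    have : 1 < (u ^ 2 + v ^ 2) ^ 2 := by
      have : 0 < u ^ 2 * v ^ 2 := by positivity
      nlinarith
    nlinarith [sq_nonneg u, sq_nonneg v]
  refine ⟨u, v, s, u ^ 2 + v ^ 2 - 1, u ^ 2 - v ^ 2, hu0, hv0, h2, hw, by ring, by ring, ?_, ?_,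
    eu, ev, rfl, l0', l1', l2'⟩
  · linear_combination 2 * hc
  · have e : 4 * (u ^ 2 * v ^ 2) * s ^ 2 = 4 * (u ^ 2 * v ^ 2) - (u ^ 2 + v ^ 2 - 1) ^ 2 := by
      linear_combination (4 * u ^ 2 * v ^ 2) * t2
        - (2 * u * v * Real.cos (p 2) - (u ^ 2 + v ^ 2 - 1)) * l2'
    have e2 : 2 * (u ^ 2 * v ^ 2) = (u ^ 2 + v ^ 2 - 1) * (u ^ 2 + v ^ 2 + 1) := by
      linear_combination -hc
    refine mul_left_cancel₀ hw.ne' ?_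
    linear_combination e + (2 - 2 * s ^ 2) * e2

theorem CurveData.bounds {p : Shape} {u v s w d : ℝ} (H : CurveData p u v s w d) :
    w < 21 / 50 ∧ -1 < d ∧ d < 1 := by
  have h1 := H.d_sq
  have h2 := H.w_pos
  refine ⟨?_, ?_, ?_⟩ <;> nlinarith [sq_nonneg d]

theorem CurveData.relations {p : Shape} {u v s w d : ℝ} (H : CurveData p u v s w d) :
    w = u ^ 2 + v ^ 2 - 1 ∧ d = u ^ 2 - v ^ 2 ∧ u ^ 4 + v ^ 4 = 1 ∧
      u + v * Real.cos (p 2) = Real.cos (p 1) ∧ v + u * Real.cos (p 2) = Real.cos (p 0) ∧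
      u * Real.cos (p 1) + v * Real.cos (p 0) = 1 ∧
      0 < Real.cos (p 0) ∧ 0 < Real.cos (p 1) ∧ Real.cos (p 2) < 0 := by
  obtain ⟨-, hd1, hd2⟩ := H.bounds
  obtain ⟨hu, hv, hs, hw, eu, ev, ed, es, s0, s1, s2, c0, c1, c2⟩ := H
  refine ⟨by linarith, by linarith, ?_, ?_, ?_, by linarith, ?_, ?_, ?_⟩
  · have : u ^ 4 + v ^ 4 = (u ^ 2) ^ 2 + (v ^ 2) ^ 2 := by ring
    rw [this, eu, ev]
    linear_combination ed / 2
  · refine mul_left_cancel₀ (mul_pos two_pos hu).ne' ?_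
    linear_combination c2 - c1 + 2 * eu
  · refine mul_left_cancel₀ (mul_pos two_pos hv).ne' ?_
    linear_combination c2 - c0 + 2 * ev
  · refine pos_of_mul_pos_right (a := 2 * v) ?_ (by positivity)
    linarith
  · refine pos_of_mul_pos_right (a := 2 * u) ?_ (by positivity)
    linarith
  · refine neg_of_mul_neg_right (a := 2 * u * v) ?_ (by positivity)
    linarith

/-- On the curve `h = 0` both `x` and `G M x` are orthogonal to the kernel of `G`, so that the
proportion between two of their components implies the others: the masses satisfy one linear
equation. -/
theorem CurveData.isLagrangeShape_iff {p : Shape} {u v s w d : ℝ} (H : CurveData p u v s w d)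
    {m : Fin 3 → ℝ} (hm : ∀ k, 0 < m k) : IsLagrangeShape m p ↔
      m 0 * u ^ 2 * (1 + v ^ 2 + u ^ 2 * v ^ 2) =
        m 1 * v ^ 2 * (1 + u ^ 2 + u ^ 2 * v ^ 2) + m 2 * d := by
  obtain ⟨hw', hd', hc, a1, a0, a2, p0, p1, -⟩ := H.relations
  obtain ⟨hu, hv, hs, hw, -, -, -, -, s0, s1, s2, c0, c1, c2⟩ := H
  obtain ⟨R0, hR0⟩ : ∃ R, R = m 0 * u ^ 3 + m 1 * v ^ 3 * Real.cos (p 2) + m 2 * Real.cos (p 1) :=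
    ⟨_, rfl⟩
  obtain ⟨R1, hR1⟩ : ∃ R, R = m 0 * u ^ 3 * Real.cos (p 2) + m 1 * v ^ 3 + m 2 * Real.cos (p 0) :=
    ⟨_, rfl⟩
  obtain ⟨R2, hR2⟩ : ∃ R, R = m 0 * u ^ 3 * Real.cos (p 1) + m 1 * v ^ 3 * Real.cos (p 0) + m 2 :=
    ⟨_, rfl⟩
  have r0 : row m p 0 = R0 * s ^ 3 := by
    simp only [row, Fin.isValue, zero_add, s0, s1, s2, hR0]; ring
  have r1 : row m p 1 = R1 * s ^ 3 := by
    simp only [row, Fin.isValue, Fin.reduceAdd, s0, s1, s2, hR1]; ring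
  have r2 : row m p 2 = R2 * s ^ 3 := by
    simp only [row, Fin.isValue, Fin.reduceAdd, s0, s1, s2, hR2]; ring
  have key : 2 * u * v * (v ^ 3 * R0 - u ^ 3 * R1) =
      w * (m 0 * u ^ 2 * (1 + v ^ 2 + u ^ 2 * v ^ 2) -
        (m 1 * v ^ 2 * (1 + u ^ 2 + u ^ 2 * v ^ 2) + m 2 * d)) := by
    rw [hR0, hR1]
    rw [hw'] at c2 ⊢
    rw [hd'] at c0 c1 ⊢
    linear_combination (m 1 * v ^ 6 - m 0 * u ^ 6) * c2 + m 2 * v ^ 4 * c1 - m 2 * u ^ 4 * c0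
      + (m 0 * u ^ 2 * (u ^ 2 - 1) - m 1 * v ^ 2 * (v ^ 2 - 1) + m 2 * (u ^ 2 - v ^ 2)) * hc
  have hs3 : s ^ 3 ≠ 0 := by positivity
  have iff1 : (v ^ 3 * R0 = u ^ 3 * R1) ↔ m 0 * u ^ 2 * (1 + v ^ 2 + u ^ 2 * v ^ 2) =
        m 1 * v ^ 2 * (1 + u ^ 2 + u ^ 2 * v ^ 2) + m 2 * d := by
    rw [← sub_eq_zero, ← sub_eq_zero (a := m 0 * u ^ 2 * _)]
    have h2uv : 2 * u * v ≠ 0 := by positivity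
    constructor
    · intro h0
      rw [h0, mul_zero] at key
      exact (mul_eq_zero.1 key.symm).resolve_left hw.ne'
    · intro h0
      rw [h0, mul_zero] at key
      exact (mul_eq_zero.1 key).resolve_left h2uv
  rw [← iff1]
  have hsum : u * R0 + v * R1 = R2 := by
    rw [hR0, hR1, hR2]
    linear_combination (m 0 * u ^ 3) * a1 + (m 1 * v ^ 3) * a0 + m 2 * a2
  constructor
  · rintro ⟨l, -, hl⟩
    have e0 := hl 0
    have e1 := hl 1
    rw [r0, s0] at e0
    rw [r1, s1] at e1
    refine mul_right_cancel₀ hs3 ?_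
    linear_combination v ^ 3 * e0 - u ^ 3 * e1
  · intro h0
    refine ⟨R2, ?_, fun i => ?_⟩
    · rw [hR2]
      have := hm 0; have := hm 1; have := hm 2
      positivity
    · fin_cases i
      · simp only [Fin.zero_eta, Fin.isValue, r0, s0]
        linear_combination (u ^ 3 * s ^ 3) * hsum - (R0 * s ^ 3) * hc + (v * s ^ 3) * h0
      · simp only [Fin.mk_one, Fin.isValue, r1, s1]
        linear_combination (v ^ 3 * s ^ 3) * hsum - (R1 * s ^ 3) * hc - (u * s ^ 3) * h0
      · simp only [Fin.reduceFinMk, Fin.isValue, r2, s2]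

/-! ### Polynomial identities on the curve -/

/-- The mass triples that satisfy the linear equation of `CurveData.isLagrangeShape_iff` with
`p = u ^ 2` and `q = v ^ 2`, in coordinates `r`, `t`. -/
theorem exists_mass_coordinates {p q d m0 m1 m2 : ℝ} (hp : 0 < p) (hq : 0 < q) (h0 : 0 < m0)
    (h1 : 0 < m1) (h2 : 0 < m2)
    (h : m0 * p * (1 + q + p * q) = m1 * q * (1 + p + p * q) + m2 * d) :
    ∃ r t, 0 < r ∧ 0 < t ∧ m0 = (r + t * d / 2) * (q * (1 + p + p * q)) ∧
      m1 = (r - t * d / 2) * (p * (1 + q + p * q)) ∧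
      m2 = t * (p * q * (1 + q + p * q) * (1 + p + p * q)) := by
  obtain ⟨t, ht⟩ : ∃ t, t = m2 / (p * q * (1 + q + p * q) * (1 + p + p * q)) := ⟨_, rfl⟩
  obtain ⟨r, hr⟩ : ∃ r, r = m0 / (q * (1 + p + p * q)) - t * d / 2 := ⟨_, rfl⟩
  have ht0 : 0 < t := by rw [ht]; positivity
  have e2 : m2 = t * (p * q * (1 + q + p * q) * (1 + p + p * q)) := by rw [ht]; field_simp
  have e0 : m0 = (r + t * d / 2) * (q * (1 + p + p * q)) := by rw [hr]; field_simp; ring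
  have e1 : m1 = (r - t * d / 2) * (p * (1 + q + p * q)) := by
    have hne : q * (1 + p + p * q) ≠ 0 := by positivity
    refine mul_right_cancel₀ hne ?_
    rw [e0, e2] at h
    linear_combination -h
  refine ⟨r, t, ?_, ht0, e0, e1, e2⟩
  have g0 : 0 < r + t * d / 2 := by
    rw [e0] at h0
    exact pos_of_mul_pos_left h0 (by positivity)
  have g1 : 0 < r - t * d / 2 := by
    rw [e1] at h1
    exact pos_of_mul_pos_left h1 (by positivity)
  linarith

section
variable {w d r t m0 m1 m2 p q : ℝ}

theorem pow_reductions (hd : d ^ 2 = 1 - 2 * w - w ^ 2) :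
    d ^ 3 = d * (1 - 2 * w - w ^ 2) ∧ d ^ 4 = (1 - 2 * w - w ^ 2) ^ 2 ∧
    d ^ 5 = d * (1 - 2 * w - w ^ 2) ^ 2 ∧ d ^ 6 = (1 - 2 * w - w ^ 2) ^ 3 ∧
    d ^ 7 = d * (1 - 2 * w - w ^ 2) ^ 3 ∧ d ^ 8 = (1 - 2 * w - w ^ 2) ^ 4 ∧
    d ^ 9 = d * (1 - 2 * w - w ^ 2) ^ 4 ∧ d ^ 10 = (1 - 2 * w - w ^ 2) ^ 5 := by
  refine ⟨?_, ?_, ?_, ?_, ?_, ?_, ?_, ?_⟩ <;> rw [← hd] <;> ring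

/-- Up to a positive factor, the derivative of `lagrangeK` at a point of the curve is
`(symmCoeff + d * skewCoeff) * v₁ + (-symmCoeff + d * skewCoeff) * v₂ + d * thirdCoeff * v₃`
(`CurveData.lagrangeK_derivative`). The exchange of the first two masses changes the signs of `d`
and of `lagrangeK`. -/
def symmCoeff (w r t : ℝ) : ℝ :=
  (1 / 4 - 9 / 4 * w - 27 / 8 * w ^ 2 - 17 / 8 * w ^ 3 - 1 / 2 * w ^ 4) * t
    + (3 / 2 - 3 / 4 * w ^ 2) * r

/-- The coefficient of `d * (v₁ + v₂)` in the derivative of `lagrangeK`, see `symmCoeff`. -/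
def skewCoeff (w r t : ℝ) : ℝ :=
  (7 / 4 + 37 / 4 * w + 99 / 8 * w ^ 2 + 61 / 8 * w ^ 3 + 9 / 4 * w ^ 4 + 1 / 4 * w ^ 5) * t
    + (-3 / 2 + 3 / 4 * w ^ 2) * r

/-- The coefficient of `d * v₃` in the derivative of `lagrangeK`, see `symmCoeff`. -/
def thirdCoeff (w r t : ℝ) : ℝ :=
  (1 + 7 / 4 * w + 5 / 2 * w ^ 2 + 11 / 8 * w ^ 3 + 3 / 8 * w ^ 4) * t
    + (w + 4) * (w ^ 2 + 2 * w + 2) / 4 * r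

/-- The coefficient of `v₁` in the derivative of `lagrangeK`; that of `v₂` follows by exchanging the
first two masses, `d ↦ -d`. -/
theorem k_coeff (hd : d ^ 2 = 1 - 2 * w - w ^ 2) (hp : p = (1 + w + d) / 2)
    (hq : q = (1 + w - d) / 2) (e0 : m0 = (r + t * d / 2) * (q * (1 + p + p * q)))
    (e1 : m1 = (r - t * d / 2) * (p * (1 + q + p * q)))
    (e2 : m2 = t * (p * q * (1 + q + p * q) * (1 + p + p * q))) :
    3 * p ^ 2 * (1 - d) * (2 * (m0 - m1) * q ^ 2 + 2 * m0 * w * p - m2 * (1 - d))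
      + p ^ 2 * (w * (w + 4)) * m2 = w ^ 2 * (w + 2) ^ 2 *
      (symmCoeff w r t + d * skewCoeff w r t) := by
  obtain ⟨e3, e4, e5, e6, e7, e8, e9, e10⟩ := pow_reductions hd
  rw [symmCoeff, skewCoeff]
  subst e0 e1 e2 hp hq
  ring_nf
  simp only [hd, e3, e4, e5, e6, e7, e8, e9, e10]
  ring

theorem k_coeff_third (hd : d ^ 2 = 1 - 2 * w - w ^ 2) (hp : p = (1 + w + d) / 2)
    (hq : q = (1 + w - d) / 2) (e0 : m0 = (r + t * d / 2) * (q * (1 + p + p * q)))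
    (e1 : m1 = (r - t * d / 2) * (p * (1 + q + p * q)))
    (e2 : m2 = t * (p * q * (1 + q + p * q) * (1 + p + p * q))) :
    w * (w + 4) * (m0 * p ^ 3 - m1 * q ^ 3) + 3 * w ^ 2 * d * m2 =
      w ^ 2 * (w + 2) ^ 2 * (d * thirdCoeff w r t) := by
  obtain ⟨e3, e4, e5, e6, e7, e8, e9, e10⟩ := pow_reductions hd
  rw [thirdCoeff]
  subst e0 e1 e2 hp hq
  ring_nf
  simp only [e3, e5, e7]
  ring

/-- The coefficient of `v₁ + v₂ - v₃` in the derivative of `lagrangeL` that comes from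
`kernelRow`. -/
theorem gram_coeff (hd : d ^ 2 = 1 - 2 * w - w ^ 2) (hp : p = (1 + w + d) / 2)
    (hq : q = (1 + w - d) / 2) (e0 : m0 = (r + t * d / 2) * (q * (1 + p + p * q)))
    (e1 : m1 = (r - t * d / 2) * (p * (1 + q + p * q)))
    (e2 : m2 = t * (p * q * (1 + q + p * q) * (1 + p + p * q))) :
    m0 * p ^ 2 * (1 - d) + m1 * q ^ 2 * (1 + d) - m2 * w =
      w ^ 2 * (w + 2) * (w + 4) * ((w + 2) * (2 * (w + 1) * r - (1 + 2 * w) * t) / 8) := by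
  obtain ⟨e3, e4, e5, e6, e7, e8, e9, e10⟩ := pow_reductions hd
  subst e0 e1 e2 hp hq
  ring_nf
  simp only [hd, e4, e6]
  ring

/-- The eigenvalue of `G M` at a point of the curve. -/
theorem eigenvalue_coeff (hd : d ^ 2 = 1 - 2 * w - w ^ 2) (hp : p = (1 + w + d) / 2)
    (hq : q = (1 + w - d) / 2) (e0 : m0 = (r + t * d / 2) * (q * (1 + p + p * q)))
    (e1 : m1 = (r - t * d / 2) * (p * (1 + q + p * q)))
    (e2 : m2 = t * (p * q * (1 + q + p * q) * (1 + p + p * q))) :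
    2 * m2 + m0 * p * (1 + d) + m1 * q * (1 - d) =
      w * (w + 2) * (w + 4) * (((3 + 3 * w + w ^ 2) * t + 2 * r) / 4) := by
  obtain ⟨e3, e4, e5, e6, e7, e8, e9, e10⟩ := pow_reductions hd
  subst e0 e1 e2 hp hq
  ring_nf
  simp only [hd, e4, e6]
  ring

/-- The sum of the partial derivatives with respect to `p` and `q` of `eulerG`, where
`p : q : 1 = sin σ₁ ^ 2 : sin σ₂ ^ 2 : sin σ₃ ^ 2`. -/
theorem euler_coeff (hd : d ^ 2 = 1 - 2 * w - w ^ 2) (hp : p = (1 + w + d) / 2)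
    (hq : q = (1 + w - d) / 2) (e0 : m0 = (r + t * d / 2) * (q * (1 + p + p * q)))
    (e1 : m1 = (r - t * d / 2) * (p * (1 + q + p * q)))
    (e2 : m2 = t * (p * q * (1 + q + p * q) * (1 + p + p * q))) :
    m2 * (q ^ 2 - 2 * p * (1 + q - p) + p ^ 2) + m0 * (q ^ 2 * (1 + p - q) - (1 - p - q)
        + p * (q ^ 2 + 1)) + m1 * q * (-1 - 2 * p * (1 + q - p) + p ^ 2)
      + (m2 * (2 * q * (1 + p - q) - q ^ 2 - p ^ 2) + m0 * p * (2 * q * (1 + p - q) - q ^ 2 + 1)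
        + m1 * ((1 - p - q) - p ^ 2 * (1 + q - p) + q * (-1 - p ^ 2))) =
      w * (w + 2) ^ 3 * d * ((1 / 2 + 11 / 8 * w + 7 / 8 * w ^ 2 + w ^ 3 / 4) * t
        + w / 4 * r) := by
  obtain ⟨e3, e4, e5, e6, e7, e8, e9, e10⟩ := pow_reductions hd
  subst e0 e1 e2 hp hq
  ring_nf
  simp only [e3, e5, e7]
  ring

end

/-- The determinant of the derivatives of `lagrangeK` and `lagrangeL` along the plane
`σ₃ = σ₁ + σ₂`, up to a factor that does not vanish (`tangency_eq`). It vanishes when the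
curve of Lagrange shapes is tangent to the plane. -/
def tangency (w r t : ℝ) : ℝ :=
  (1 + 1 / 2 * w + 1 / 2 * w ^ 2 + w ^ 3 + 1 / 4 * w ^ 4) * r
    + (-1 / 2 - 11 / 4 * w - w ^ 2 + 7 / 2 * w ^ 3 + 31 / 8 * w ^ 4 + 13 / 8 * w ^ 5
      + 1 / 4 * w ^ 6) * t

theorem tangency_eq (w r t : ℝ) : symmCoeff w r t * (3 + 3 * w + w ^ 2)
    - (1 - 2 * w - w ^ 2) * (skewCoeff w r t + thirdCoeff w r t) = (w + 4) * tangency w r t := by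
  rw [symmCoeff, skewCoeff, thirdCoeff, tangency]
  ring

/-- If the third mass is not too large, the curve of Lagrange shapes crosses the plane. -/
theorem tangency_pos {w r t : ℝ} (hw : 0 < w) (hw' : w < 21 / 50) (ht : 0 < t)
    (hr : 2 * t ≤ r) : 0 < tangency w r t := by
  have h1 : (1 + 1 / 2 * w + 1 / 2 * w ^ 2 + w ^ 3 + 1 / 4 * w ^ 4) * (2 * t) ≤
      (1 + 1 / 2 * w + 1 / 2 * w ^ 2 + w ^ 3 + 1 / 4 * w ^ 4) * r := by gcongr
  have h2 : 0 < (3 / 2 - 7 / 4 * w + 11 / 2 * w ^ 3 + 35 / 8 * w ^ 4 + 13 / 8 * w ^ 5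
      + 1 / 4 * w ^ 6) * t := by
    have : 0 < 3 / 2 - 7 / 4 * w := by linarith
    positivity
  rw [tangency]
  linarith

/-- At a tangency the two derivatives are still independent, provided that `d ≠ 0`. -/
theorem nondegenerate_of_tangency_eq_zero {w r t : ℝ} (hw : 0 < w) (hw' : w < 21 / 50)
    (ht : 0 < t) (h : tangency w r t = 0) :
    0 < (skewCoeff w r t + thirdCoeff w r t) * ((w + 2) * (2 * (w + 1) * r - (1 + 2 * w) * t) / 8
        + 2 * (((3 + 3 * w + w ^ 2) * t + 2 * r) / 4))
      - ((3 + 3 * w + w ^ 2) * t + 2 * r) / 4 * (3 + 3 * w + w ^ 2) * thirdCoeff w r t := by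
  -- the masses at the tangency, up to a positive factor `k`
  obtain ⟨k, hk⟩ : ∃ k, k = t / (1 + 1 / 2 * w + 1 / 2 * w ^ 2 + w ^ 3 + 1 / 4 * w ^ 4) := ⟨_, rfl⟩
  have hk0 : 0 < k := by rw [hk]; positivity
  have et : t = k * (1 + 1 / 2 * w + 1 / 2 * w ^ 2 + w ^ 3 + 1 / 4 * w ^ 4) := by
    rw [hk]; field_simp
  have er : r = k * (1 / 2 + 11 / 4 * w + w ^ 2 - 7 / 2 * w ^ 3 - 31 / 8 * w ^ 4 - 13 / 8 * w ^ 5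
      - 1 / 4 * w ^ 6) := by
    have hne : 1 + 1 / 2 * w + 1 / 2 * w ^ 2 + w ^ 3 + 1 / 4 * w ^ 4 ≠ 0 := by positivity
    refine mul_left_cancel₀ hne ?_
    rw [tangency] at h
    rw [et] at h
    linear_combination h
  -- the negative terms have degree at least five and are small for `w < 1 / 2`
  have hpol : 0 < 9 / 4 + 99 / 8 * w + 435 / 16 * w ^ 2 + 897 / 32 * w ^ 3 + 165 / 32 * w ^ 4
      - 395 / 16 * w ^ 5 - 1241 / 32 * w ^ 6 - 4227 / 128 * w ^ 7 - 4885 / 256 * w ^ 8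
      - 4043 / 512 * w ^ 9 - 1201 / 512 * w ^ 10 - 247 / 512 * w ^ 11 - 1 / 16 * w ^ 12
      - 1 / 256 * w ^ 13 := by
    have hle : ∀ n : ℕ, w ^ (n + 5) ≤ w * (1 / 16) := by
      intro n
      have h1 : w ^ (n + 4) ≤ 1 / 16 := by
        calc w ^ (n + 4) ≤ w ^ 4 := pow_le_pow_of_le_one hw.le (by linarith) (by omega)
          _ ≤ (1 / 2) ^ 4 := by gcongr; linarith
          _ = 1 / 16 := by norm_num
      calc w ^ (n + 5) = w * w ^ (n + 4) := by ring
        _ ≤ w * (1 / 16) := by gcongr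
    have := hle 0; have := hle 1; have := hle 2; have := hle 3; have := hle 4
    have := hle 5; have := hle 6; have := hle 7; have := hle 8
    have : 0 < w ^ 2 := by positivity
    have : 0 < w ^ 3 := by positivity
    have : 0 < w ^ 4 := by positivity
    norm_num at *
    linarith
  have hfin : 0 < k ^ 2 * (w ^ 2 * (w + 2) * (w + 1)) := by positivity
  refine lt_of_lt_of_eq (mul_pos hfin hpol) ?_
  rw [skewCoeff, thirdCoeff, er, et]
  ring

/-- The elementary linear algebra behind the implicit function theorem: two equations for the
derivatives of the two functions that define the Lagrange shapes, with `τ = v₁ + v₂ - v₃`. -/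
theorem eq_zero_of_linear_equations {w d r t v0 v1 τ : ℝ} (hd : d ^ 2 = 1 - 2 * w - w ^ 2)
    (hw : 0 < w) (hw' : w < 21 / 50) (hr : 0 < r) (ht : 0 < t)
    (hK : (symmCoeff w r t + d * (skewCoeff w r t + thirdCoeff w r t)) * v0
      + (-symmCoeff w r t + d * (skewCoeff w r t + thirdCoeff w r t)) * v1
      - d * thirdCoeff w r t * τ = 0)
    (hL : (w + 2) * (2 * (w + 1) * r - (1 + 2 * w) * t) / 8 * τ
      - ((3 + 3 * w + w ^ 2) * t + 2 * r) / 4 * ((3 + 3 * w + w ^ 2 + d) * v0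
        + (3 + 3 * w + w ^ 2 - d) * v1 - 2 * τ) = 0) :
    (tangency w r t ≠ 0 → τ = 0 → v0 = 0 ∧ v1 = 0) ∧
    (tangency w r t = 0 → d ≠ 0 → v0 = 0 → v1 = 0 ∧ τ = 0) := by
  have hJ := tangency_eq w r t
  have hW := nondegenerate_of_tangency_eq_zero hw hw' ht (r := r)
  have hl : 0 < ((3 + 3 * w + w ^ 2) * t + 2 * r) / 4 := by positivity
  have he : 0 < 3 + 3 * w + w ^ 2 := by positivity
  have hd1 : d < 1 := by nlinarith
  have hd2 : -1 < d := by nlinarith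
  have hm : 3 + 3 * w + w ^ 2 - d ≠ 0 := by nlinarith
  generalize symmCoeff w r t = a at *
  generalize skewCoeff w r t = b at *
  generalize thirdCoeff w r t = c at *
  generalize tangency w r t = j at *
  generalize ((3 + 3 * w + w ^ 2) * t + 2 * r) / 4 = l at *
  generalize (w + 2) * (2 * (w + 1) * r - (1 + 2 * w) * t) / 8 = P at *
  constructor
  · rintro hj rfl
    have hL' : (3 + 3 * w + w ^ 2 + d) * v0 + (3 + 3 * w + w ^ 2 - d) * v1 = 0 := by
      refine mul_left_cancel₀ hl.ne' ?_
      linear_combination -hL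
    have hj' : (w + 4) * j ≠ 0 := mul_ne_zero (by positivity) hj
    constructor
    · refine mul_left_cancel₀ (mul_ne_zero two_ne_zero hj') ?_
      rw [← hJ, ← hd]
      linear_combination (3 + 3 * w + w ^ 2 - d) * hK + (a - d * (b + c)) * hL'
    · refine mul_left_cancel₀ (mul_ne_zero two_ne_zero hj') ?_
      rw [← hJ, ← hd]
      linear_combination (a + d * (b + c)) * hL' - (3 + 3 * w + w ^ 2 + d) * hK
  · rintro rfl hd0 rfl
    have hW := hW rfl
    rw [mul_zero, ← hd] at hJ
    have hX : (b + c) * ((3 + 3 * w + w ^ 2 - d) * v1) = (3 + 3 * w + w ^ 2) * c * τ := by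
      refine mul_left_cancel₀ hd0 ?_
      linear_combination (3 + 3 * w + w ^ 2) * hK + v1 * hJ
    have hτ : τ = 0 := by
      refine (mul_eq_zero.1 (?_ : τ * _ = 0)).resolve_right hW.ne'
      linear_combination (b + c) * hL + l * hX
    subst hτ
    refine ⟨(mul_eq_zero.1 ?_).resolve_left hm, rfl⟩
    refine mul_left_cancel₀ hl.ne' ?_
    linear_combination -hL

/-! ### Two equations for the Lagrange shapes -/

/-- The first of the two functions whose common zeros are the Lagrange shapes: the first two
components of `G M x` and `x` are proportional. -/
def lagrangeK (m : Fin 3 → ℝ) (σ : Shape) : ℝ :=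
  Real.sin (σ 1) ^ 3 * row m σ 0 - Real.sin (σ 0) ^ 3 * row m σ 1

/-- The inner product of `G M x` and `(sin σ₁, sin σ₂, - sin σ₃)`. -/
def kernelRow (m : Fin 3 → ℝ) (σ : Shape) : ℝ :=
  Real.sin (σ 0) * row m σ 0 + Real.sin (σ 1) * row m σ 1 - Real.sin (σ 2) * row m σ 2

/-- The inner product of `x` and `(sin σ₁, sin σ₂, - sin σ₃)`. -/
def kernelX (σ : Shape) : ℝ :=
  Real.sin (σ 0) ^ 4 + Real.sin (σ 1) ^ 4 - Real.sin (σ 2) ^ 4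

/-- The second of the two functions whose common zeros are the Lagrange shapes: the inner products
of `G M x` and `x` with `(sin σ₁, sin σ₂, - sin σ₃)`, which spans the kernel of `G` on the plane
`σ₃ = σ₁ + σ₂`, are in the proportion of the last components. -/
def lagrangeL (m : Fin 3 → ℝ) (σ : Shape) : ℝ :=
  Real.sin (σ 2) ^ 3 * kernelRow m σ - row m σ 2 * kernelX σ

section
variable {m : Fin 3 → ℝ} {σ p : Shape}

theorem isLagrangeShape_of_eq_zero (hσ : σ ∈ U) (hrow : 0 < row m σ 2) (hK : lagrangeK m σ = 0)
    (hL : lagrangeL m σ = 0) : IsLagrangeShape m σ := by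
  have s0 := sin_pos_of_mem_U hσ 0
  have s1 := sin_pos_of_mem_U hσ 1
  have s2 := sin_pos_of_mem_U hσ 2
  rw [lagrangeK] at hK
  rw [lagrangeL, kernelRow, kernelX] at hL
  have e0 : Real.sin (σ 0) ^ 3 * row m σ 2 = Real.sin (σ 2) ^ 3 * row m σ 0 := by
    have hne : Real.sin (σ 0) ^ 4 + Real.sin (σ 1) ^ 4 ≠ 0 := by positivity
    refine mul_left_cancel₀ hne ?_
    linear_combination (-Real.sin (σ 0) ^ 3) * hL - (Real.sin (σ 2) ^ 3 * Real.sin (σ 1)) * hK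
  have e1 : Real.sin (σ 1) ^ 3 * row m σ 2 = Real.sin (σ 2) ^ 3 * row m σ 1 := by
    refine mul_left_cancel₀ (pow_pos s0 3).ne' ?_
    linear_combination Real.sin (σ 1) ^ 3 * e0 + Real.sin (σ 2) ^ 3 * hK
  refine ⟨row m σ 2 / Real.sin (σ 2) ^ 3, by positivity, fun i => ?_⟩
  fin_cases i
  · simp only [Fin.zero_eta, Fin.isValue]
    field_simp
    linear_combination -e0
  · simp only [Fin.mk_one, Fin.isValue]
    field_simp
    linear_combination -e1
  · simp only [Fin.reduceFinMk, Fin.isValue]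
    field_simp

theorem IsLagrangeShape.eq_zero (h : IsLagrangeShape m σ) :
    lagrangeK m σ = 0 ∧ lagrangeL m σ = 0 := by
  obtain ⟨l, -, hl⟩ := h
  rw [lagrangeK, lagrangeL, kernelRow, kernelX, hl, hl, hl]
  constructor <;> ring

theorem contDiff_lagrangeK : ContDiff ℝ 1 (lagrangeK m) := by
  unfold lagrangeK row
  fun_prop

theorem contDiff_lagrangeL : ContDiff ℝ 1 (lagrangeL m) := by
  unfold lagrangeL kernelRow kernelX row
  fun_prop

theorem hasFDerivAt_sin_apply (p : Shape) (i : Fin 3) :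
    HasFDerivAt (fun σ : Shape => Real.sin (σ i))
      (Real.cos (p i) • ContinuousLinearMap.proj (R := ℝ) (φ := fun _ : Fin 3 => ℝ) i) p :=
  (hasFDerivAt_apply i p).sin

theorem hasFDerivAt_cos_apply (p : Shape) (i : Fin 3) :
    HasFDerivAt (fun σ : Shape => Real.cos (σ i))
      (-Real.sin (p i) • ContinuousLinearMap.proj (R := ℝ) (φ := fun _ : Fin 3 => ℝ) i) p :=
  (hasFDerivAt_apply i p).cos

theorem exists_hasFDerivAt_lagrangeK (m : Fin 3 → ℝ) (p : Shape) :
    ∃ K' : Shape →L[ℝ] ℝ, HasFDerivAt (lagrangeK m) K' p ∧ ∀ v, K' v =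
      (3 * Real.sin (p 0) ^ 2 * Real.cos (p 0) * ((m 0 - m 1) * Real.sin (p 1) ^ 3
        - 2 * Real.cos (p 2) * m 0 * Real.sin (p 0) ^ 3
        - m 2 * Real.sin (p 2) ^ 3 * Real.cos (p 0))
        + m 2 * Real.sin (p 2) ^ 3 * Real.sin (p 0) ^ 4) * v 0
      + (3 * Real.sin (p 1) ^ 2 * Real.cos (p 1) * ((m 0 - m 1) * Real.sin (p 0) ^ 3
        + 2 * Real.cos (p 2) * m 1 * Real.sin (p 1) ^ 3
        + m 2 * Real.sin (p 2) ^ 3 * Real.cos (p 1))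
        - m 2 * Real.sin (p 2) ^ 3 * Real.sin (p 1) ^ 4) * v 1
      + (Real.sin (p 2) * (m 0 * Real.sin (p 0) ^ 6 - m 1 * Real.sin (p 1) ^ 6)
        + 3 * Real.sin (p 2) ^ 2 * Real.cos (p 2) * m 2 *
          (Real.cos (p 1) * Real.sin (p 1) ^ 3 - Real.cos (p 0) * Real.sin (p 0) ^ 3)) * v 2 := by
  have hs := hasFDerivAt_sin_apply p
  have hc := hasFDerivAt_cos_apply p
  have hder := (((((hs 0).pow 3).mul ((hs 1).pow 3)).const_mul (m 0 - m 1)).add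
    ((hc 2).mul ((((hs 1).pow 6).const_mul (m 1)).sub (((hs 0).pow 6).const_mul (m 0))))).add
    ((((hs 2).pow 3).mul (((hc 1).mul ((hs 1).pow 3)).sub ((hc 0).mul ((hs 0).pow 3)))).const_mul
      (m 2))
  refine ⟨_, hder.congr_of_eventuallyEq (Filter.Eventually.of_forall fun σ => ?_), fun v => ?_⟩
  · simp [lagrangeK, row]
    ring
  · simp
    ring

theorem kernelRow_eq (m : Fin 3 → ℝ) (σ : Shape) : kernelRow m σ =
    m 0 * Real.sin (σ 0) ^ 3 * (Real.sin (σ 0) + Real.cos (σ 2) * Real.sin (σ 1)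
      - Real.cos (σ 1) * Real.sin (σ 2))
    + m 1 * Real.sin (σ 1) ^ 3 * (Real.cos (σ 2) * Real.sin (σ 0) + Real.sin (σ 1)
      - Real.cos (σ 0) * Real.sin (σ 2))
    + m 2 * Real.sin (σ 2) ^ 3 * (Real.cos (σ 1) * Real.sin (σ 0)
      + Real.cos (σ 0) * Real.sin (σ 1) - Real.sin (σ 2)) := by
  simp only [kernelRow, row, Fin.isValue, Fin.reduceAdd, zero_add]
  ring

/-- On the plane, `G M x` is orthogonal to the kernel of `G`, whatever the masses. -/
theorem kernelRow_eq_zero (hp : p ∈ eulerPlane) : kernelRow m p = 0 := by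
  obtain ⟨h0, h1, h2, -⟩ := addition_formulas hp
  rw [kernelRow_eq]
  linear_combination (m 0 * Real.sin (p 0) ^ 3) * h0 + (m 1 * Real.sin (p 1) ^ 3) * h1
    - (m 2 * Real.sin (p 2) ^ 3) * h2

/-- At a point where `kernelRow` and `kernelX` vanish, only their own derivatives contribute. The
vector `G (sin σ₁, sin σ₂, - sin σ₃)` vanishes on the plane, so that its derivative is a multiple of
`v₁ + v₂ - v₃`. -/
theorem exists_hasFDerivAt_lagrangeL (hp : p ∈ eulerPlane) (hx : kernelX p = 0) :
    ∃ L' : Shape →L[ℝ] ℝ, HasFDerivAt (lagrangeL m) L' p ∧ ∀ v, L' v =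
      Real.sin (p 2) ^ 3 * (m 0 * Real.sin (p 0) ^ 3 * Real.cos (p 0)
        + m 1 * Real.sin (p 1) ^ 3 * Real.cos (p 1)
        + m 2 * Real.sin (p 2) ^ 3 * Real.cos (p 2)) * (v 0 + v 1 - v 2)
      - 4 * row m p 2 * (Real.sin (p 0) ^ 3 * Real.cos (p 0) * v 0
        + Real.sin (p 1) ^ 3 * Real.cos (p 1) * v 1
        - Real.sin (p 2) ^ 3 * Real.cos (p 2) * v 2) := by
  have hs := hasFDerivAt_sin_apply p
  have hc := hasFDerivAt_cos_apply p
  have hR0 : kernelRow m p = 0 := kernelRow_eq_zero hp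
  obtain ⟨a0, a1, a2, a3, a4, a5⟩ := addition_formulas hp
  have h0 := (((hs 0).pow 3).const_mul (m 0)).mul
    (((hs 0).add ((hc 2).mul (hs 1))).sub ((hc 1).mul (hs 2)))
  have h1 := (((hs 1).pow 3).const_mul (m 1)).mul
    ((((hc 2).mul (hs 0)).add (hs 1)).sub ((hc 0).mul (hs 2)))
  have h2 := (((hs 2).pow 3).const_mul (m 2)).mul
    ((((hc 1).mul (hs 0)).add ((hc 0).mul (hs 1))).sub (hs 2))
  have hR : HasFDerivAt (kernelRow m) _ p :=
    ((h0.add h1).add h2).congr_of_eventuallyEq (Filter.Eventually.of_forall (kernelRow_eq m))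
  have hX : HasFDerivAt kernelX _ p := (((hs 0).pow 4).add ((hs 1).pow 4)).sub ((hs 2).pow 4)
  have hrow : DifferentiableAt ℝ (fun σ => row m σ 2) p := by
    unfold row
    fun_prop
  have hder := (((hs 2).pow 3).mul hR).sub (hrow.hasFDerivAt.mul hX)
  refine ⟨_, hder, fun v => ?_⟩
  have b0 : Real.sin (p 0) + Real.cos (p 2) * Real.sin (p 1)
      - Real.cos (p 1) * Real.sin (p 2) = 0 := by linear_combination a0
  have b1 : Real.cos (p 2) * Real.sin (p 0) + Real.sin (p 1)
      - Real.cos (p 0) * Real.sin (p 2) = 0 := by linear_combination a1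
  have b2 : Real.cos (p 1) * Real.sin (p 0)
      + Real.cos (p 0) * Real.sin (p 1) - Real.sin (p 2) = 0 := by linear_combination -a2
  simp [hR0, hx, b0, b1, b2]
  linear_combination -(Real.sin (p 2) ^ 3 * (m 0 * Real.sin (p 0) ^ 3) * (v 1 - v 2)) * a3
    - (Real.sin (p 2) ^ 3 * (m 1 * Real.sin (p 1) ^ 3) * (v 0 - v 2)) * a4
    - (Real.sin (p 2) ^ 3 * (m 2 * Real.sin (p 2) ^ 3) * (v 0 + v 1)) * a5

end

/-! ### The derivatives at a point of the curve -/

/-- The parameters `r`, `t` of the masses at a limit of Lagrange relative equilibria. -/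
structure MassData (m : Fin 3 → ℝ) (u v d r t : ℝ) : Prop where
  r_pos : 0 < r
  t_pos : 0 < t
  m0 : m 0 = (r + t * d / 2) * (v ^ 2 * (1 + u ^ 2 + u ^ 2 * v ^ 2))
  m1 : m 1 = (r - t * d / 2) * (u ^ 2 * (1 + v ^ 2 + u ^ 2 * v ^ 2))
  m2 : m 2 = t * (u ^ 2 * v ^ 2 * (1 + v ^ 2 + u ^ 2 * v ^ 2) * (1 + u ^ 2 + u ^ 2 * v ^ 2))

section
variable {m : Fin 3 → ℝ} {p : Shape} {u v s w d r t : ℝ}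

theorem CurveData.exists_massData (H : CurveData p u v s w d) (hm : ∀ k, 0 < m k)
    (hL : IsLagrangeShape m p) : ∃ r t, MassData m u v d r t := by
  rw [H.isLagrangeShape_iff hm] at hL
  have hu := H.u_pos
  have hv := H.v_pos
  obtain ⟨r, t, h1, h2, h3, h4, h5⟩ := exists_mass_coordinates (p := u ^ 2) (q := v ^ 2)
    (by positivity) (by positivity) (hm 0) (hm 1) (hm 2) hL
  exact ⟨r, t, h1, h2, h3, h4, h5⟩

theorem CurveData.lagrangeK_derivative (H : CurveData p u v s w d) (M : MassData m u v d r t)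
    (V : Shape) :
    ((3 * Real.sin (p 0) ^ 2 * Real.cos (p 0) * ((m 0 - m 1) * Real.sin (p 1) ^ 3
        - 2 * Real.cos (p 2) * m 0 * Real.sin (p 0) ^ 3
        - m 2 * Real.sin (p 2) ^ 3 * Real.cos (p 0))
        + m 2 * Real.sin (p 2) ^ 3 * Real.sin (p 0) ^ 4) * V 0
      + (3 * Real.sin (p 1) ^ 2 * Real.cos (p 1) * ((m 0 - m 1) * Real.sin (p 0) ^ 3
        + 2 * Real.cos (p 2) * m 1 * Real.sin (p 1) ^ 3
        + m 2 * Real.sin (p 2) ^ 3 * Real.cos (p 1))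
        - m 2 * Real.sin (p 2) ^ 3 * Real.sin (p 1) ^ 4) * V 1
      + (Real.sin (p 2) * (m 0 * Real.sin (p 0) ^ 6 - m 1 * Real.sin (p 1) ^ 6)
        + 3 * Real.sin (p 2) ^ 2 * Real.cos (p 2) * m 2 *
          (Real.cos (p 1) * Real.sin (p 1) ^ 3 - Real.cos (p 0) * Real.sin (p 0) ^ 3)) * V 2)
      * (4 * u ^ 2 * v ^ 2) = s ^ 5 * (w ^ 2 * (w + 2) ^ 2) *
      ((symmCoeff w r t + d * (skewCoeff w r t + thirdCoeff w r t)) * V 0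
      + (-symmCoeff w r t + d * (skewCoeff w r t + thirdCoeff w r t)) * V 1
      - d * thirdCoeff w r t * (V 0 + V 1 - V 2)) := by
  obtain ⟨-, -, hc, -⟩ := H.relations
  obtain ⟨hu, hv, hs, hw, eu, ev, ed, es, s0, s1, s2, c0, c1, c2⟩ := H
  obtain ⟨hr, ht, e0, e1, e2⟩ := M
  have huv : 4 * u ^ 2 * v ^ 2 = 2 * w * (w + 2) := by
    rw [mul_assoc, eu, ev]
    linear_combination -ed
  have huvs : 4 * u ^ 2 * v ^ 2 * s ^ 2 = w * (w + 4) := by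
    rw [huv]
    linear_combination w * es
  have k0 := k_coeff ed eu ev e0 e1 e2
  have k1 := k_coeff (p := v ^ 2) (q := u ^ 2) (d := -d) (m0 := m 1) (m1 := m 0) (m2 := m 2)
    (w := w) (r := r) (t := t) (by rw [neg_sq, ed]) (by rw [ev]; ring) (by rw [eu]; ring)
    (by rw [e1]; ring) (by rw [e0]; ring) (by rw [e2]; ring)
  have k2 := k_coeff_third ed eu ev e0 e1 e2
  rw [s0, s1, s2]
  have g0 : (3 * (u * s) ^ 2 * Real.cos (p 0) * ((m 0 - m 1) * (v * s) ^ 3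
        - 2 * Real.cos (p 2) * m 0 * (u * s) ^ 3 - m 2 * s ^ 3 * Real.cos (p 0))
        + m 2 * s ^ 3 * (u * s) ^ 4) * (4 * u ^ 2 * v ^ 2) = s ^ 5 * (w ^ 2 * (w + 2) ^ 2) *
        (symmCoeff w r t + d * skewCoeff w r t) := by
    calc _ = s ^ 5 * (3 * (u ^ 2) ^ 2 * (2 * v * Real.cos (p 0)) * (2 * (m 0 - m 1) * (v ^ 2) ^ 2
          - 2 * (2 * u * v * Real.cos (p 2)) * m 0 * u ^ 2 - m 2 * (2 * v * Real.cos (p 0)))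
          + (u ^ 2) ^ 2 * (4 * u ^ 2 * v ^ 2 * s ^ 2) * m 2) := by ring
      _ = _ := by
        rw [c0, c2, huvs]
        linear_combination s ^ 5 * k0
  have g1 : (3 * (v * s) ^ 2 * Real.cos (p 1) * ((m 0 - m 1) * (u * s) ^ 3
        + 2 * Real.cos (p 2) * m 1 * (v * s) ^ 3 + m 2 * s ^ 3 * Real.cos (p 1))
        - m 2 * s ^ 3 * (v * s) ^ 4) * (4 * u ^ 2 * v ^ 2) = s ^ 5 * (w ^ 2 * (w + 2) ^ 2) *
        (-symmCoeff w r t + d * skewCoeff w r t) := by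
    calc _ = s ^ 5 * (3 * (v ^ 2) ^ 2 * (2 * u * Real.cos (p 1)) * (2 * (m 0 - m 1) * (u ^ 2) ^ 2
          + 2 * (2 * u * v * Real.cos (p 2)) * m 1 * v ^ 2 + m 2 * (2 * u * Real.cos (p 1)))
          - (v ^ 2) ^ 2 * (4 * u ^ 2 * v ^ 2 * s ^ 2) * m 2) := by ring
      _ = _ := by
        rw [c1, c2, huvs]
        linear_combination (-s ^ 5) * k1
  have g2 : (s * (m 0 * (u * s) ^ 6 - m 1 * (v * s) ^ 6) + 3 * s ^ 2 * Real.cos (p 2) * m 2 *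
          (Real.cos (p 1) * (v * s) ^ 3 - Real.cos (p 0) * (u * s) ^ 3)) * (4 * u ^ 2 * v ^ 2) =
        s ^ 5 * (w ^ 2 * (w + 2) ^ 2) * (d * thirdCoeff w r t) := by
    calc _ = s ^ 5 * (4 * u ^ 2 * v ^ 2 * s ^ 2 * (m 0 * (u ^ 2) ^ 3 - m 1 * (v ^ 2) ^ 3)
          + 3 * (2 * u * v * Real.cos (p 2)) * m 2 * ((2 * u * Real.cos (p 1)) * (v ^ 2) ^ 2
          - (2 * v * Real.cos (p 0)) * (u ^ 2) ^ 2)) := by ring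
      _ = _ := by
        have g3 : (1 + d) * (v ^ 2) ^ 2 - (1 - d) * (u ^ 2) ^ 2 = -(d * w) := by
          have e3 : d ^ 3 = d * (1 - 2 * w - w ^ 2) := by rw [← ed]; ring
          rw [eu, ev]
          linear_combination e3 / 2
        rw [c0, c1, c2, huvs, g3]
        linear_combination s ^ 5 * k2
  linear_combination V 0 * g0 + V 1 * g1 + V 2 * g2

theorem CurveData.lagrangeL_derivative (H : CurveData p u v s w d) (M : MassData m u v d r t)
    (V : Shape) :
    (Real.sin (p 2) ^ 3 * (m 0 * Real.sin (p 0) ^ 3 * Real.cos (p 0)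
        + m 1 * Real.sin (p 1) ^ 3 * Real.cos (p 1)
        + m 2 * Real.sin (p 2) ^ 3 * Real.cos (p 2)) * (V 0 + V 1 - V 2)
      - 4 * row m p 2 * (Real.sin (p 0) ^ 3 * Real.cos (p 0) * V 0
        + Real.sin (p 1) ^ 3 * Real.cos (p 1) * V 1
        - Real.sin (p 2) ^ 3 * Real.cos (p 2) * V 2)) * (2 * u * v) =
      s ^ 6 * (w ^ 2 * (w + 2) * (w + 4)) *
      ((w + 2) * (2 * (w + 1) * r - (1 + 2 * w) * t) / 8 * (V 0 + V 1 - V 2)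
      - ((3 + 3 * w + w ^ 2) * t + 2 * r) / 4 * ((3 + 3 * w + w ^ 2 + d) * V 0
        + (3 + 3 * w + w ^ 2 - d) * V 1 - 2 * (V 0 + V 1 - V 2))) := by
  obtain ⟨hu, hv, hs, hw, eu, ev, ed, es, s0, s1, s2, c0, c1, c2⟩ := H
  obtain ⟨hr, ht, e0, e1, e2⟩ := M
  have hP := gram_coeff ed eu ev e0 e1 e2
  have hl := eigenvalue_coeff ed eu ev e0 e1 e2
  have e3 : d ^ 3 = d * (1 - 2 * w - w ^ 2) := by rw [← ed]; ring
  have A : (u ^ 2) ^ 2 * (1 - d) + w = w / 2 * (3 + 3 * w + w ^ 2 + d) := by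
    rw [eu]
    linear_combination (-1 / 4 - w / 2) * ed - e3 / 4
  have B : (v ^ 2) ^ 2 * (1 + d) + w = w / 2 * (3 + 3 * w + w ^ 2 - d) := by
    rw [ev]
    linear_combination (-1 / 4 - w / 2) * ed + e3 / 4
  have hrow : row m p 2 = s ^ 3 / 2 * (2 * m 2 + m 0 * u ^ 2 * (2 * u * Real.cos (p 1))
      + m 1 * v ^ 2 * (2 * v * Real.cos (p 0))) := by
    simp only [row, Fin.isValue, Fin.reduceAdd, s0, s1, s2]
    ring
  rw [c0, c1, hl] at hrow
  rw [s0, s1, s2, hrow]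
  calc _ = s ^ 6 * ((m 0 * (u ^ 2) ^ 2 * (2 * v * Real.cos (p 0))
        + m 1 * (v ^ 2) ^ 2 * (2 * u * Real.cos (p 1))
        + m 2 * (2 * u * v * Real.cos (p 2))) * (V 0 + V 1 - V 2)
        - 2 * (w * (w + 2) * (w + 4) * (((3 + 3 * w + w ^ 2) * t + 2 * r) / 4)) *
          ((u ^ 2) ^ 2 * (2 * v * Real.cos (p 0)) * V 0
          + (v ^ 2) ^ 2 * (2 * u * Real.cos (p 1)) * V 1
          - (2 * u * v * Real.cos (p 2)) * V 2)) := by ring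
    _ = _ := by
      rw [c0, c1, c2]
      linear_combination s ^ 6 * (V 0 + V 1 - V 2) * hP
        - s ^ 6 * 2 * (w * (w + 2) * (w + 4) * (((3 + 3 * w + w ^ 2) * t + 2 * r) / 4)) *
          (V 0 * A + V 1 * B)

end

/-! ### The arcs of Lagrange shapes at the plane -/

theorem gramDet_eq_mul (σ : Shape) : gramDet σ =
    (Real.cos (σ 0 - σ 1) - Real.cos (σ 2)) * (Real.cos (σ 2) - Real.cos (σ 0 + σ 1)) := by
  rw [gramDet, Real.cos_sub, Real.cos_add]
  have h0 := Real.sin_sq_add_cos_sq (σ 0)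
  have h1 := Real.sin_sq_add_cos_sq (σ 1)
  linear_combination (-Real.sin (σ 1) ^ 2 ) * h0 + (Real.cos (σ 0) ^ 2 - 1) * h1

theorem gramDet_eq_zero {p : Shape} (hp : p ∈ eulerPlane) : gramDet p = 0 := by
  have h : p 2 = p 0 + p 1 := hp
  rw [gramDet_eq_mul, h, sub_self, mul_zero]

/-- Near the plane, the Gram determinant is positive on the side that satisfies the triangle
inequality. -/
theorem eventually_gramDet_pos {p : Shape} (hU : p ∈ U) (hp : p ∈ eulerPlane) :
    ∀ᶠ σ in nhds p, 0 < σ 0 + σ 1 - σ 2 → 0 < gramDet σ := by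
  have h : p 2 = p 0 + p 1 := hp
  have h1 : ∀ᶠ σ : Shape in nhds p, 0 < Real.cos (σ 0 - σ 1) - Real.cos (σ 2) := by
    have hc : Continuous fun σ : Shape => Real.cos (σ 0 - σ 1) - Real.cos (σ 2) := by fun_prop
    refine hc.continuousAt.eventually (lt_mem_nhds ?_)
    beta_reduce
    rw [h, Real.cos_sub, Real.cos_add]
    nlinarith [mul_pos (sin_pos_of_mem_U hU 0) (sin_pos_of_mem_U hU 1)]
  have h2 : ∀ᶠ σ : Shape in nhds p, σ 0 + σ 1 < Real.pi := by
    have hc : Continuous fun σ : Shape => σ 0 + σ 1 := by fun_prop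
    exact hc.continuousAt.eventually (gt_mem_nhds (h ▸ (hU 2).2 : p 0 + p 1 < Real.pi))
  filter_upwards [h1, h2, isOpen_U.mem_nhds hU] with σ h3 h4 h5 h6
  rw [gramDet_eq_mul]
  refine mul_pos h3 (sub_pos.2 (Real.cos_lt_cos_of_nonneg_of_le_pi (h5 2).1.le h4.le ?_))
  linarith

section
variable {m : Fin 3 → ℝ} {p : Shape} {u v s w d r t : ℝ}

/-- A limit of Lagrange shapes on the plane is orthogonal to the kernel of the Gram matrix and
satisfies the equation of Lagrange shapes. -/
theorem LREContinuationReaches.isLagrangeShape (hm : ∀ k, 0 < m k) (hU : p ∈ U)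
    (hp : p ∈ eulerPlane) (h : LREContinuationReaches m p) :
    kernelX p = 0 ∧ IsLagrangeShape m p := by
  obtain ⟨γ, hγ, rfl, hS⟩ := h
  set p := γ 0
  let C : Set Shape := {σ | (∀ i, 0 ≤ row m σ i) ∧
    ∀ i j, row m σ i * Real.sin (σ j) ^ 3 = row m σ j * Real.sin (σ i) ^ 3}
  have hrow : ∀ i, Continuous fun σ : Shape => row m σ i := fun i => by
    unfold row
    fun_prop
  have hC : IsClosed C := by
    have h1 : IsClosed {σ : Shape | ∀ i, 0 ≤ row m σ i} := by
      simp only [ofPred_forall]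
      exact isClosed_iInter fun i => isClosed_le continuous_const (hrow i)
    have h2 : IsClosed {σ : Shape |
        ∀ i j, row m σ i * Real.sin (σ j) ^ 3 = row m σ j * Real.sin (σ i) ^ 3} := by
      simp only [ofPred_forall]
      exact isClosed_iInter fun i => isClosed_iInter fun j =>
        isClosed_eq ((hrow i).mul (by fun_prop)) ((hrow j).mul (by fun_prop))
    exact h1.inter h2
  have hpC : p ∈ C := by
    have h0 : (0 : ℝ) ∈ closure (Ioc (0 : ℝ) 1) := by
      rw [closure_Ioc zero_ne_one]
      simp
    refine closure_minimal (s := lreShapes m) ?_ hC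
      (((hγ 0 (by simp)).mono Ioc_subset_Icc_self).mem_closure h0 hS)
    rintro _ ⟨Q, hQ, rfl⟩
    obtain ⟨hQU, ⟨l, hl, hlr⟩, -⟩ := hQ.isLagrangeShape hm
    refine ⟨fun i => ?_, fun i j => ?_⟩
    · rw [hlr]
      exact (mul_pos hl (pow_pos (sin_pos_of_mem_U hQU i) 3)).le
    · rw [hlr, hlr]
      ring
  obtain ⟨h1, h2⟩ := hpC
  have hs := sin_pos_of_mem_U hU
  obtain ⟨l, hl⟩ : ∃ l, l = row m p 2 / Real.sin (p 2) ^ 3 := ⟨_, rfl⟩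
  have hlr : ∀ i, row m p i = l * Real.sin (p i) ^ 3 := fun i => by
    have := hs 2
    rw [hl]
    field_simp
    exact h2 i 2
  have hl0 : 0 ≤ l := by
    have := hs 2
    have := h1 2
    rw [hl]
    positivity
  -- a positive vector is not in the kernel, which is spanned by a vector with mixed signs
  have hl1 : l ≠ 0 := by
    intro h0
    have e0 := hlr 0
    have e1 := hlr 1
    rw [h0] at e0 e1
    simp only [row, Fin.isValue, Fin.reduceAdd, zero_add] at e0 e1
    obtain ⟨-, -, -, h3, -, -⟩ := addition_formulas hp
    have t2 := Real.sin_sq_add_cos_sq (p 2)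
    have y1 := mul_pos (hm 1) (pow_pos (hs 1) 3)
    have y2 := mul_pos (hm 2) (pow_pos (hs 2) 3)
    have q1 := mul_pos y1 (pow_pos (hs 2) 2)
    have q2 := mul_pos y2 (mul_pos (hs 1) (hs 2))
    have : m 1 * Real.sin (p 1) ^ 3 * Real.sin (p 2) ^ 2
        + m 2 * Real.sin (p 2) ^ 3 * (Real.sin (p 1) * Real.sin (p 2)) = 0 := by
      linear_combination e1 - Real.cos (p 2) * e0 - m 2 * Real.sin (p 2) ^ 3 * h3
        + m 1 * Real.sin (p 1) ^ 3 * t2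
    linarith
  refine ⟨?_, l, lt_of_le_of_ne hl0 hl1.symm, hlr⟩
  refine (mul_eq_zero.1 ?_).resolve_left hl1
  rw [← kernelRow_eq_zero (m := m) hp, kernelRow, kernelX, hlr, hlr, hlr]
  ring

theorem CurveData.kernelX_eq_zero (H : CurveData p u v s w d) : kernelX p = 0 := by
  obtain ⟨-, -, h, -⟩ := H.relations
  rw [kernelX, H.sin0, H.sin1, H.sin2]
  linear_combination s ^ 4 * h

theorem CurveData.lt_one (H : CurveData p u v s w d) : u < 1 := by
  obtain ⟨-, -, h, -⟩ := H.relations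
  have hv := pow_pos H.v_pos 4
  by_contra! h1
  have := one_le_pow₀ h1 (n := 4)
  linarith

/-- The first mass is off the axis. -/
theorem CurveData.height_lt_one (H : CurveData p u v s w d) (hm : ∀ k, 0 < m k) (hU : p ∈ U)
    (hL : IsLagrangeShape m p) : 0 < 1 - height m p 0 ^ 2 := by
  obtain ⟨l, hl, hrow⟩ := hL
  obtain ⟨-, -, -, -, -, -, -, c1, c2⟩ := H.relations
  have hs := sin_pos_of_mem_U hU
  have hW := weight_pos hm hU
  have hlt : Real.sin (p 0) < Real.sin (p 2) := by
    rw [H.sin0, H.sin2]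
    have := H.lt_one
    have := H.s_pos
    nlinarith
  have hlt3 : Real.sin (p 0) ^ 3 * Real.cos (p 1) < Real.sin (p 2) ^ 3 := by
    calc Real.sin (p 0) ^ 3 * Real.cos (p 1) ≤ Real.sin (p 0) ^ 3 * 1 := by
          have := hs 0
          gcongr
          exact Real.cos_le_one _
      _ < _ := by
        rw [mul_one]
        exact pow_lt_pow_left₀ hlt (hs 0).le (by norm_num)
  have h0 := hrow 0
  simp only [row, Fin.isValue, zero_add] at h0
  rw [height, mul_pow, eigen_eq hU hrow, Real.sq_sqrt (by positivity), sub_pos, div_mul_eq_mul_div,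
    div_lt_one hW, weight, Fin.sum_univ_three]
  have a1 : 0 < m 1 * Real.sin (p 1) ^ 3 *
      (Real.sin (p 1) ^ 3 + Real.sin (p 0) ^ 3 * (-Real.cos (p 2))) :=
    mul_pos (mul_pos (hm 1) (pow_pos (hs 1) 3))
      (add_pos (pow_pos (hs 1) 3) (mul_pos (pow_pos (hs 0) 3) (by linarith)))
  have a2 : 0 < m 2 * Real.sin (p 2) ^ 3 *
      (Real.sin (p 2) ^ 3 - Real.sin (p 0) ^ 3 * Real.cos (p 1)) :=
    mul_pos (mul_pos (hm 2) (pow_pos (hs 2) 3)) (by linarith)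
  have e : l * (Real.sin (p 0) ^ 3) ^ 2 = Real.sin (p 0) ^ 3 * (m 0 * Real.sin (p 0) ^ 3
      + m 1 * Real.sin (p 1) ^ 3 * Real.cos (p 2) + m 2 * Real.sin (p 2) ^ 3 * Real.cos (p 1)) := by
    rw [h0]; ring
  rw [e]
  linarith

theorem eventually_row_pos (hU : p ∈ U) (hL : IsLagrangeShape m p) :
    ∀ᶠ σ in nhds p, 0 < row m σ 2 := by
  have hc : Continuous fun σ => row m σ 2 := by
    unfold row
    fun_prop
  obtain ⟨l, hl, hrow⟩ := hL
  refine hc.continuousAt.eventually (lt_mem_nhds ?_)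
  beta_reduce
  rw [hrow]
  exact mul_pos hl (pow_pos (sin_pos_of_mem_U hU 2) 3)

theorem CurveData.lagrangeK_linear (H : CurveData p u v s w d) (M : MassData m u v d r t) :
    ∃ K' : Shape →L[ℝ] ℝ, HasFDerivAt (lagrangeK m) K' p ∧ ∀ V, K' V = 0 →
      (symmCoeff w r t + d * (skewCoeff w r t + thirdCoeff w r t)) * V 0
      + (-symmCoeff w r t + d * (skewCoeff w r t + thirdCoeff w r t)) * V 1
      - d * thirdCoeff w r t * (V 0 + V 1 - V 2) = 0 := by
  obtain ⟨K', hK', hV⟩ := exists_hasFDerivAt_lagrangeK m p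
  refine ⟨K', hK', fun V h0 => ?_⟩
  have h := H.lagrangeK_derivative M V
  rw [← hV, h0, zero_mul] at h
  have hs := H.s_pos
  have hw := H.w_pos
  exact (mul_eq_zero.1 h.symm).resolve_left (by positivity)

theorem CurveData.lagrangeL_linear (H : CurveData p u v s w d) (hp : p ∈ eulerPlane)
    (M : MassData m u v d r t) :
    ∃ L' : Shape →L[ℝ] ℝ, HasFDerivAt (lagrangeL m) L' p ∧ ∀ V, L' V = 0 →
      (w + 2) * (2 * (w + 1) * r - (1 + 2 * w) * t) / 8 * (V 0 + V 1 - V 2)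
      - ((3 + 3 * w + w ^ 2) * t + 2 * r) / 4 * ((3 + 3 * w + w ^ 2 + d) * V 0
        + (3 + 3 * w + w ^ 2 - d) * V 1 - 2 * (V 0 + V 1 - V 2)) = 0 := by
  obtain ⟨L', hL', hV⟩ := exists_hasFDerivAt_lagrangeL (m := m) hp H.kernelX_eq_zero
  refine ⟨L', hL', fun V h0 => ?_⟩
  have h := H.lagrangeL_derivative M V
  rw [← hV, h0, zero_mul] at h
  have hs := H.s_pos
  have hw := H.w_pos
  exact (mul_eq_zero.1 h.symm).resolve_left (by positivity)

/-- The signed distance from the plane, as a linear form. -/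
def planeForm : Shape →L[ℝ] ℝ :=
  ContinuousLinearMap.proj (R := ℝ) (φ := fun _ : Fin 3 => ℝ) 0 + ContinuousLinearMap.proj 1
    - ContinuousLinearMap.proj 2

theorem planeForm_apply (V : Shape) : planeForm V = V 0 + V 1 - V 2 := rfl

theorem planeForm_sub (hp : p ∈ eulerPlane) (σ : Shape) :
    planeForm (σ - p) = σ 0 + σ 1 - σ 2 := by
  have h : p 2 = p 0 + p 1 := hp
  rw [planeForm_apply]
  simp only [Pi.sub_apply]
  linarith

/-- An arc of common zeros of `lagrangeK` and `lagrangeL` that crosses the plane carries the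
coupling of Lagrange relative equilibria. -/
theorem CurveData.hasLRECoupling_of_crossing (H : CurveData p u v s w d) (hm : ∀ k, 0 < m k)
    (hU : p ∈ U) (hp : p ∈ eulerPlane) (hL : IsLagrangeShape m p) {ε : ℝ} {γ : ℝ → Shape}
    (hγ : IsRegularArc p ε γ) (h : ∀ t ∈ Ioo (-ε) ε, lagrangeK m (γ t) = 0 ∧
      lagrangeL m (γ t) = 0 ∧ planeForm (γ t - p) = t) : HasLRECoupling m p := by
  obtain ⟨δ, hδ, hle, hP⟩ := hγ.exists_shorter ((eventually_row_pos hU hL).and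
    ((eventually_gramDet_pos hU hp).and (isOpen_U.mem_nhds hU)))
  refine hasLRECoupling_of_arc hm hU hL (H.height_lt_one hm hU hL) (gramDet_eq_zero hp)
    (hγ.mono hδ hle) fun t ht => ?_
  obtain ⟨h1, h2, h3⟩ := hP t ⟨by linarith [ht.1], ht.2⟩
  obtain ⟨h4, h5, h6⟩ := h t ⟨by linarith [ht.1], ht.2.trans_le hle⟩
  rw [planeForm_sub hp] at h6
  exact ⟨isLagrangeShape_of_eq_zero h3 h1 h4 h5, h2 (h6.symm ▸ ht.1)⟩

theorem CurveData.hasLRECoupling_of_tangency_ne_zero (H : CurveData p u v s w d)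
    (hm : ∀ k, 0 < m k) (hU : p ∈ U) (hp : p ∈ eulerPlane) (hL : IsLagrangeShape m p)
    (M : MassData m u v d r t) (hT : tangency w r t ≠ 0) : HasLRECoupling m p := by
  obtain ⟨K', hK', hK⟩ := H.lagrangeK_linear M
  obtain ⟨L', hL', hL''⟩ := H.lagrangeL_linear hp M
  obtain ⟨ε, γ, hγ, h, -⟩ := exists_regularArc planeForm contDiff_lagrangeK.contDiffAt
    contDiff_lagrangeL.contDiffAt hK' hL' hL.eq_zero.1 hL.eq_zero.2 fun V h1 h2 h3 => by
      rw [planeForm_apply] at h3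
      obtain ⟨e0, e1⟩ := (eq_zero_of_linear_equations H.d_sq H.w_pos H.bounds.1 M.r_pos M.t_pos
        (hK V h1) (hL'' V h2)).1 hT h3
      have e2 : V 2 = 0 := by linarith
      ext k
      fin_cases k <;> assumption
  exact H.hasLRECoupling_of_crossing hm hU hp hL hγ h

/-- At a tangency, the arc need not cross the plane; but a continuation of Lagrange relative
equilibria that reaches the plane runs along one of its halves. -/
theorem CurveData.hasLRECoupling_of_reaches (H : CurveData p u v s w d)
    (hm : ∀ k, 0 < m k) (hU : p ∈ U) (hp : p ∈ eulerPlane) (hL : IsLagrangeShape m p)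
    (M : MassData m u v d r t) (hT : tangency w r t = 0) (hd : d ≠ 0)
    (h : LREContinuationReaches m p) : HasLRECoupling m p := by
  obtain ⟨K', hK', hK⟩ := H.lagrangeK_linear M
  obtain ⟨L', hL', hL''⟩ := H.lagrangeL_linear hp M
  obtain ⟨ε, γ, hγ, -, hloc⟩ := exists_regularArc (ContinuousLinearMap.proj 0)
    contDiff_lagrangeK.contDiffAt
    contDiff_lagrangeL.contDiffAt hK' hL' hL.eq_zero.1 hL.eq_zero.2 fun V h1 h2 h3 => by
      have e0 : V 0 = 0 := h3
      obtain ⟨e1, e2⟩ := (eq_zero_of_linear_equations H.d_sq H.w_pos H.bounds.1 M.r_pos M.t_pos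
        (hK V h1) (hL'' V h2)).2 hT hd e0
      have e2 : V 2 = 0 := by linarith
      ext k
      fin_cases k <;> assumption
  have hS : ∀ σ ∈ lreShapes m, IsLagrangeShape m σ ∧ 0 < gramDet σ := by
    rintro _ ⟨Q, hQ, rfl⟩
    exact (hQ.isLagrangeShape hm).2
  obtain ⟨Γ, hΓ, hΓ0, hΓS⟩ := h
  obtain ⟨δ, γ', hγ', h'⟩ := exists_half_arc (S := lreShapes m) _ hγ
    (hloc.mono fun σ h1 h2 => h1 (hS σ h2).1.eq_zero.1 (hS σ h2).1.eq_zero.2)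
    (fun h1 => (hS p h1).2.ne' (gramDet_eq_zero hp)) hΓ hΓ0 hΓS
  exact hasLRECoupling_of_arc hm hU hL (H.height_lt_one hm hU hL) (gramDet_eq_zero hp)
    hγ' fun t ht => hS _ (h' t ht)

theorem CurveData.symmetric (H : CurveData p u v s w d) (M : MassData m u v d r t) (hU : p ∈ U)
    (hd : d = 0) : p 0 = p 1 ∧ m 0 = m 1 := by
  have huv : u ^ 2 = v ^ 2 := by rw [H.u_sq, H.v_sq, hd]; ring
  have huv' : u = v := (sq_eq_sq₀ H.u_pos.le H.v_pos.le).1 huv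
  refine ⟨Real.injOn_cos ⟨(hU 0).1.le, (hU 0).2.le⟩ ⟨(hU 1).1.le, (hU 1).2.le⟩ ?_, ?_⟩
  · have h0 := H.cos0
    have h1 := H.cos1
    have hv := H.v_pos
    rw [huv'] at h1
    refine mul_left_cancel₀ (by positivity : 2 * v ≠ 0) ?_
    rw [h0, h1, hd]
    ring
  · rw [M.m0, M.m1, huv, hd]
    ring

theorem lagrangeK_eq_zero_of_symmetric {σ : Shape} (hm : m 0 = m 1) (hσ : σ 0 = σ 1) :
    lagrangeK m σ = 0 := by
  simp only [lagrangeK, row, Fin.isValue, Fin.reduceAdd, zero_add, hm, hσ]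
  ring

/-- In the isosceles case the Lagrange shapes contain isosceles ones, which cross the plane. -/
theorem CurveData.hasLRECoupling_of_isosceles (H : CurveData p u v s w d)
    (hm : ∀ k, 0 < m k) (hU : p ∈ U) (hp : p ∈ eulerPlane) (hL : IsLagrangeShape m p)
    (M : MassData m u v d r t) (hd : d = 0) : HasLRECoupling m p := by
  obtain ⟨hp01, hm01⟩ := H.symmetric M hU hd
  obtain ⟨L', hL', hL''⟩ := H.lagrangeL_linear hp M
  obtain ⟨ε, γ, hγ, h, -⟩ := exists_regularArc (p := p) planeForm
    (f₁ := fun σ => σ 0 - σ 1) (by fun_prop)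
    contDiff_lagrangeL.contDiffAt ((hasFDerivAt_apply 0 p).sub (hasFDerivAt_apply 1 p)) hL'
    (sub_eq_zero.2 hp01) hL.eq_zero.2 fun V h1 h2 h3 => by
      have e1 : V 0 - V 1 = 0 := h1
      have e2 := hL'' V h2
      rw [planeForm_apply] at h3
      rw [h3, ← sub_eq_zero.1 e1] at e2
      have hw := H.w_pos
      have hr := M.r_pos
      have ht := M.t_pos
      have e0 : V 0 = 0 := by
        refine (mul_eq_zero.1 (?_ : (((3 + 3 * w + w ^ 2) * t + 2 * r) * (3 + 3 * w + w ^ 2)) * V 0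
          = 0)).resolve_left (by positivity)
        linear_combination -2 * e2
      have e1 : V 1 = 0 := by linarith
      have e2 : V 2 = 0 := by linarith
      ext k
      fin_cases k <;> assumption
  exact H.hasLRECoupling_of_crossing hm hU hp hL hγ fun t ht =>
    ⟨lagrangeK_eq_zero_of_symmetric hm01 (sub_eq_zero.1 (h t ht).1), (h t ht).2⟩

end

/-! ### Euler relative equilibria on a rotating meridian -/

/-- The equation for the shapes of Euler relative equilibria on a rotating meridian, in the plane
`σ₃ = σ₁ + σ₂`. -/
def eulerG (m : Fin 3 → ℝ) (σ : Shape) : ℝ :=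
  m 2 * (Real.sin (σ 2) ^ 2 *
    (Real.sin (σ 1) ^ 4 * (Real.sin (σ 2) ^ 2 + Real.sin (σ 0) ^ 2 - Real.sin (σ 1) ^ 2)
      - Real.sin (σ 0) ^ 4 * (Real.sin (σ 2) ^ 2 + Real.sin (σ 1) ^ 2 - Real.sin (σ 0) ^ 2)))
  + m 0 * (Real.sin (σ 0) ^ 2 *
    (Real.sin (σ 1) ^ 4 * (Real.sin (σ 2) ^ 2 + Real.sin (σ 0) ^ 2 - Real.sin (σ 1) ^ 2)
      - Real.sin (σ 2) ^ 4 * (Real.sin (σ 2) ^ 2 - Real.sin (σ 0) ^ 2 - Real.sin (σ 1) ^ 2)))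
  + m 1 * (Real.sin (σ 1) ^ 2 *
    (Real.sin (σ 2) ^ 4 * (Real.sin (σ 2) ^ 2 - Real.sin (σ 0) ^ 2 - Real.sin (σ 1) ^ 2)
      - Real.sin (σ 0) ^ 4 * (Real.sin (σ 2) ^ 2 + Real.sin (σ 1) ^ 2 - Real.sin (σ 0) ^ 2)))

section
variable {m : Fin 3 → ℝ} {σ p : Shape} {u v s w d r t : ℝ}

/-- Up to a factor without zeros, `eulerG` is the compatibility of the three balance equations along
the meridian, as equations for the amplitude and the phase of the centrifugal force. -/
theorem eulerG_eq (hU : σ ∈ U) (hσ : σ ∈ eulerPlane) : eulerG m σ =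
    -((Real.sin (σ 0) * Real.sin (σ 1) * Real.sin (σ 2)) ^ 3 *
      ((m 0 / Real.sin (σ 1) ^ 2 - m 1 / Real.sin (σ 0) ^ 2) * Real.sin (2 * σ 2)
      + (m 1 / Real.sin (σ 2) ^ 2 + m 2 / Real.sin (σ 1) ^ 2) * Real.sin (2 * σ 0)
      - (m 2 / Real.sin (σ 0) ^ 2 + m 0 / Real.sin (σ 2) ^ 2) * Real.sin (2 * σ 1))) := by
  obtain ⟨l0, l1, l2⟩ := law_of_cosines hσ
  have h0 := sin_pos_of_mem_U hU 0
  have h1 := sin_pos_of_mem_U hU 1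
  have h2 := sin_pos_of_mem_U hU 2
  rw [eulerG, ← l2, show Real.sin (σ 2) ^ 2 + Real.sin (σ 0) ^ 2 - Real.sin (σ 1) ^ 2 =
    2 * Real.sin (σ 0) * Real.sin (σ 2) * Real.cos (σ 1) by rw [l1]; ring,
    show Real.sin (σ 2) ^ 2 + Real.sin (σ 1) ^ 2 - Real.sin (σ 0) ^ 2 =
    2 * Real.sin (σ 1) * Real.sin (σ 2) * Real.cos (σ 0) by rw [l0]; ring,
    Real.sin_two_mul, Real.sin_two_mul, Real.sin_two_mul]
  field_simp
  ring

/-- The configuration on the meridian `y = 0` with the colatitudes `θ`. -/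
def meridianConfig (θ : Fin 3 → ℝ) : Config := fun i => !₂[Real.sin (θ i), 0, Real.cos (θ i)]

theorem inner_meridianConfig (θ : Fin 3 → ℝ) (i j : Fin 3) :
    inner ℝ (meridianConfig θ i) (meridianConfig θ j) = Real.cos (θ i - θ j) := by
  rw [inner_eq_sum, Real.cos_sub]
  simp [meridianConfig]
  ring

theorem onMeridian_meridianConfig (θ : Fin 3 → ℝ) : OnMeridian (meridianConfig θ) := by
  refine ⟨!₂[0, 1, 0], fun h => ?_, ?_, fun i => ?_⟩
  · simpa using congrArg (fun v : E3 => v 1) h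
  · simp [inner_eq_sum, axis]
  · simp [inner_eq_sum, meridianConfig]

/-- The balance of forces along the meridian. -/
theorem isBalanced_meridianConfig (hU : σ ∈ U) {θ : Fin 3 → ℝ} {ω : ℝ}
    (hin : ∀ k, inner ℝ (meridianConfig θ (k + 1)) (meridianConfig θ (k + 2)) = Real.cos (σ k))
    (h : ∀ i, -(ω ^ 2 / 2) * Real.sin (2 * θ i) =
      m (i + 1) * Real.sin (θ (i + 1) - θ i) / Real.sin (σ (i + 2)) ^ 3
      + m (i + 2) * Real.sin (θ (i + 2) - θ i) / Real.sin (σ (i + 1)) ^ 3) :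
    IsBalanced m (meridianConfig θ) ω := by
  rw [isBalanced_iff hU hin]
  intro i
  have h1 := (inner_of_shape hin i).1
  have h2 := (inner_of_shape hin i).2
  rw [← h1, ← h2, inner_meridianConfig, inner_meridianConfig]
  have ha : axis - meridianConfig θ i 2 • meridianConfig θ i =
      (-Real.sin (θ i)) • (!₂[Real.cos (θ i), 0, -Real.sin (θ i)] : E3) := by
    have := Real.sin_sq_add_cos_sq (θ i)
    ext k
    fin_cases k
    · simp [axis, meridianConfig]
      ring
    · simp [axis, meridianConfig]
    · simp [axis, meridianConfig]
      linear_combination -this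
  have hj : ∀ j, meridianConfig θ j - Real.cos (θ i - θ j) • meridianConfig θ i =
      Real.sin (θ j - θ i) • (!₂[Real.cos (θ i), 0, -Real.sin (θ i)] : E3) := by
    intro j
    have := Real.sin_sq_add_cos_sq (θ i)
    rw [Real.cos_sub, Real.sin_sub]
    ext k
    fin_cases k
    · simp [meridianConfig]
      linear_combination (-Real.sin (θ j)) * this
    · simp [meridianConfig]
    · simp [meridianConfig]
      linear_combination (-Real.cos (θ j)) * this
  rw [ha, hj, hj, smul_smul, smul_smul, smul_smul, ← add_smul]
  congr 1
  have := h i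
  rw [Real.sin_two_mul] at this
  simp only [meridianConfig, Matrix.cons_val]
  linear_combination this

/-- If `sin (2 * σ₃) ≠ 0`, the balance at the first two masses determines the angular velocity and
the axis, and `eulerG = 0` gives the balance at the third. -/
theorem mem_ereShapes (hm : ∀ k, 0 < m k) (hU : σ ∈ U) (hσ : σ ∈ eulerPlane)
    (hs : Real.sin (2 * σ 2) ≠ 0) (hG : eulerG m σ = 0) : σ ∈ ereShapes m := by
  have h0 := sin_pos_of_mem_U hU 0
  have h1 := sin_pos_of_mem_U hU 1
  have h2 := sin_pos_of_mem_U hU 2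
  rw [eulerG_eq hU hσ, neg_eq_zero, mul_eq_zero,
    or_iff_right (pow_ne_zero 3 (mul_pos (mul_pos h0 h1) h2).ne')] at hG
  have hp : σ 2 = σ 0 + σ 1 := hσ
  set F0 := -(m 1 / Real.sin (σ 2) ^ 2 + m 2 / Real.sin (σ 1) ^ 2) with hF0
  set F1 := m 2 / Real.sin (σ 0) ^ 2 + m 0 / Real.sin (σ 2) ^ 2 with hF1
  -- polar coordinates: the amplitude and the phase of the centrifugal force
  obtain ⟨R, ψ, hR, hsin, hcos⟩ : ∃ R ψ : ℝ, 0 ≤ R ∧ R * Real.sin ψ = F0 ∧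
      R * Real.cos ψ = (F1 - F0 * Real.cos (2 * σ 2)) / Real.sin (2 * σ 2) :=
    ⟨‖(⟨(F1 - F0 * Real.cos (2 * σ 2)) / Real.sin (2 * σ 2), F0⟩ : ℂ)‖, Complex.arg _,
      norm_nonneg _, Complex.norm_mul_sin_arg _, Complex.norm_mul_cos_arg _⟩
  have hcos' : R * Real.cos ψ * Real.sin (2 * σ 2) = F1 - F0 * Real.cos (2 * σ 2) := by
    rw [hcos]; field_simp
  have e1 : R * Real.sin (ψ + 2 * σ 2) = F1 := by
    rw [Real.sin_add]
    linear_combination hcos' + Real.cos (2 * σ 2) * hsin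
  have e2 : R * Real.sin (ψ + 2 * σ 1) = m 0 / Real.sin (σ 1) ^ 2 - m 1 / Real.sin (σ 0) ^ 2 := by
    have h3 : Real.sin (2 * σ 0) = Real.sin (2 * σ 2) * Real.cos (2 * σ 1)
        - Real.cos (2 * σ 2) * Real.sin (2 * σ 1) := by
      rw [← Real.sin_sub, hp]
      ring_nf
    rw [Real.sin_add]
    refine mul_right_cancel₀ hs ?_
    linear_combination Real.sin (2 * σ 1) * hcos'
      + Real.cos (2 * σ 1) * Real.sin (2 * σ 2) * hsin - F0 * h3 - hG
  let θ : Fin 3 → ℝ := ![ψ / 2, ψ / 2 + σ 2, ψ / 2 + σ 1]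
  have hn : ∀ i, ‖meridianConfig θ i‖ = 1 := fun i => by
    rw [← sq_eq_sq₀ (norm_nonneg _) zero_le_one, ← real_inner_self_eq_norm_sq,
      inner_meridianConfig]
    simp
  have hin : ∀ k, inner ℝ (meridianConfig θ (k + 1)) (meridianConfig θ (k + 2)) =
      Real.cos (σ k) := by
    intro k
    rw [inner_meridianConfig]
    fin_cases k
    · simp [θ, hp]
    · simp [θ]
    · simp [θ]
  refine ⟨meridianConfig θ, ⟨⟨√(2 * R), (isSolution_rotZ_iff hm _ _).2
    ⟨hn, fun _ _ => inner_sq_ne_one hU hin, isBalanced_meridianConfig hU hin fun i => ?_⟩⟩,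
    onMeridian_meridianConfig θ⟩, (shape_eq_iff hn hU).2 hin⟩
  rw [Real.sq_sqrt (by positivity)]
  fin_cases i
  · have a : 2 * (ψ / 2) = ψ := by ring
    simp [θ, a]
    rw [hsin, hF0]
    field_simp
  · have a : 2 * (ψ / 2 + σ 2) = ψ + 2 * σ 2 := by ring
    have b : ψ / 2 + σ 1 - (ψ / 2 + σ 2) = -σ 0 := by rw [hp]; ring
    have c : ψ / 2 - (ψ / 2 + σ 2) = -σ 2 := by ring
    simp [θ, a, b, c]
    rw [e1, hF1]
    field_simp
    ring
  · have a : 2 * (ψ / 2 + σ 1) = ψ + 2 * σ 1 := by ring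
    have b : ψ / 2 - (ψ / 2 + σ 1) = -σ 1 := by ring
    have c : ψ / 2 + σ 2 - (ψ / 2 + σ 1) = σ 0 := by rw [hp]; ring
    simp [θ, a, b, c]
    rw [e2]
    field_simp
    ring

theorem contDiff_eulerG : ContDiff ℝ 1 (eulerG m) := by
  unfold eulerG
  fun_prop

theorem exists_hasFDerivAt_eulerG (m : Fin 3 → ℝ) (p : Shape) :
    ∃ G' : Shape →L[ℝ] ℝ, HasFDerivAt (eulerG m) G' p ∧ ∀ V a b c A B C,
      a = Real.sin (p 0) ^ 2 → b = Real.sin (p 1) ^ 2 → c = Real.sin (p 2) ^ 2 →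
      A = 2 * Real.sin (p 0) * Real.cos (p 0) * V 0 →
      B = 2 * Real.sin (p 1) * Real.cos (p 1) * V 1 →
      C = 2 * Real.sin (p 2) * Real.cos (p 2) * V 2 → G' V =
      m 2 * (C * (b ^ 2 * (c + a - b) - a ^ 2 * (c + b - a))
        + c * (2 * b * B * (c + a - b) + b ^ 2 * (C + A - B)
          - 2 * a * A * (c + b - a) - a ^ 2 * (C + B - A)))
      + m 0 * (A * (b ^ 2 * (c + a - b) - c ^ 2 * (c - a - b))
        + a * (2 * b * B * (c + a - b) + b ^ 2 * (C + A - B)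
          - 2 * c * C * (c - a - b) - c ^ 2 * (C - A - B)))
      + m 1 * (B * (c ^ 2 * (c - a - b) - a ^ 2 * (c + b - a))
        + b * (2 * c * C * (c - a - b) + c ^ 2 * (C - A - B)
          - 2 * a * A * (c + b - a) - a ^ 2 * (C + B - A))) := by
  have hs := hasFDerivAt_sin_apply p
  have a1 := ((hs 2).pow 2).add ((hs 0).pow 2) |>.sub ((hs 1).pow 2)
  have b1 := ((hs 2).pow 2).add ((hs 1).pow 2) |>.sub ((hs 0).pow 2)
  have c1 := ((hs 2).pow 2).sub ((hs 0).pow 2) |>.sub ((hs 1).pow 2)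
  have hder := (((((hs 2).pow 2).mul ((((hs 1).pow 4).mul a1).sub
      (((hs 0).pow 4).mul b1))).const_mul (m 2)).add
    ((((hs 0).pow 2).mul ((((hs 1).pow 4).mul a1).sub
      (((hs 2).pow 4).mul c1))).const_mul (m 0))).add
    ((((hs 1).pow 2).mul ((((hs 2).pow 4).mul c1).sub
      (((hs 0).pow 4).mul b1))).const_mul (m 1))
  refine ⟨_, hder, ?_⟩
  rintro V _ _ _ _ _ _ rfl rfl rfl rfl rfl rfl
  simp
  ring

/-- On the curve `h = 0`, the equation `eulerG = 0` is a multiple of the linear equation for the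
masses. The first conjunct is `eulerG` in terms of `u ^ 2` and `v ^ 2`. -/
theorem CurveData.eulerG_eq_zero (H : CurveData p u v s w d) (hm : ∀ k, 0 < m k)
    (hL : IsLagrangeShape m p) :
    m 2 * ((v ^ 2) ^ 2 * (1 + u ^ 2 - v ^ 2) - (u ^ 2) ^ 2 * (1 + v ^ 2 - u ^ 2))
      + m 0 * (u ^ 2 * ((v ^ 2) ^ 2 * (1 + u ^ 2 - v ^ 2) - (1 - u ^ 2 - v ^ 2)))
      + m 1 * (v ^ 2 * ((1 - u ^ 2 - v ^ 2) - (u ^ 2) ^ 2 * (1 + v ^ 2 - u ^ 2))) = 0 ∧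
    eulerG m p = 0 := by
  rw [H.isLagrangeShape_iff hm] at hL
  obtain ⟨hw, hd, hc, -⟩ := H.relations
  have key : m 2 * ((v ^ 2) ^ 2 * (1 + u ^ 2 - v ^ 2) - (u ^ 2) ^ 2 * (1 + v ^ 2 - u ^ 2))
      + m 0 * (u ^ 2 * ((v ^ 2) ^ 2 * (1 + u ^ 2 - v ^ 2) - (1 - u ^ 2 - v ^ 2)))
      + m 1 * (v ^ 2 * ((1 - u ^ 2 - v ^ 2) - (u ^ 2) ^ 2 * (1 + v ^ 2 - u ^ 2))) = 0 := by
    rw [hd] at hL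
    linear_combination (u ^ 2 + v ^ 2 - 1) * hL
      + (m 2 * (u ^ 2 - v ^ 2) - m 0 * u ^ 2 * v ^ 2 + m 1 * u ^ 2 * v ^ 2) * hc
  refine ⟨key, ?_⟩
  rw [eulerG, H.sin0, H.sin1, H.sin2]
  linear_combination s ^ 8 * key

theorem CurveData.hasEREContinuation_of_arc (H : CurveData p u v s w d) (hm : ∀ k, 0 < m k)
    (hU : p ∈ U) {ε : ℝ} {γ : ℝ → Shape} (hγ : IsRegularArc p ε γ)
    (h : ∀ t ∈ Ioo (-ε) ε, γ t ∈ eulerPlane ∧ eulerG m (γ t) = 0) : HasEREContinuation m p := by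
  have h2 : ∀ᶠ σ in nhds p, Real.sin (2 * σ 2) ≠ 0 := by
    have hc : Continuous fun σ : Shape => Real.sin (2 * σ 2) := by fun_prop
    refine hc.continuousAt.eventually (isOpen_ne.mem_nhds ?_)
    obtain ⟨-, -, -, -, -, -, -, -, hc2⟩ := H.relations
    have := sin_pos_of_mem_U hU 2
    simp only [ne_eq, Real.sin_two_mul]
    exact mul_ne_zero (mul_ne_zero two_ne_zero this.ne') hc2.ne
  obtain ⟨δ, hδ, hle, hP⟩ := hγ.exists_shorter (h2.and (isOpen_U.mem_nhds hU))
  refine ⟨δ, γ, hγ.mono hδ hle, fun t ht => ?_⟩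
  obtain ⟨h3, h4⟩ := h t ⟨by linarith [ht.1], ht.2.trans_le hle⟩
  exact ⟨mem_ereShapes hm (hP t ht).2 h3 (hP t ht).1 h4, h3⟩

/-- The derivative of `eulerG` does not vanish along the plane. -/
theorem CurveData.eulerG_derivative (H : CurveData p u v s w d) (hm : ∀ k, 0 < m k)
    (hL : IsLagrangeShape m p) (M : MassData m u v d r t) (hd : d ≠ 0) :
    ∃ G' ℓ : Shape →L[ℝ] ℝ, HasFDerivAt (eulerG m) G' p ∧
      ∀ V, G' V = 0 → planeForm V = 0 → ℓ V = 0 → V = 0 := by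
  obtain ⟨G', hG', hV⟩ := exists_hasFDerivAt_eulerG m p
  -- the difference of the derivatives of `sin σ₁ ^ 2 / sin σ₃ ^ 2` and `sin σ₂ ^ 2 / sin σ₃ ^ 2`,
  -- up to a factor
  let ℓ : Shape →L[ℝ] ℝ := (2 * Real.sin (p 0) * Real.cos (p 0)) • ContinuousLinearMap.proj
      (R := ℝ) (φ := fun _ : Fin 3 => ℝ) 0
    - (2 * Real.sin (p 1) * Real.cos (p 1)) • ContinuousLinearMap.proj 1
    - ((u ^ 2 - v ^ 2) * (2 * Real.sin (p 2) * Real.cos (p 2))) • ContinuousLinearMap.proj 2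
  refine ⟨G', ℓ, hG', fun V h1 h2 h3 => ?_⟩
  have h3 : 2 * Real.sin (p 0) * Real.cos (p 0) * V 0 - 2 * Real.sin (p 1) * Real.cos (p 1) * V 1
    - (u ^ 2 - v ^ 2) * (2 * Real.sin (p 2) * Real.cos (p 2)) * V 2 = 0 := h3
  obtain ⟨hG0, -⟩ := H.eulerG_eq_zero hm hL
  obtain ⟨-, -, -, -, -, -, c0, c1, c2⟩ := H.relations
  have hu := H.u_pos
  have hv := H.v_pos
  have hs := H.s_pos
  have hw := H.w_pos
  have hr := M.r_pos
  have ht := M.t_pos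
  have he := euler_coeff H.d_sq H.u_sq H.v_sq M.m0 M.m1 M.m2
  rw [hV V ((u ^ 2) * s ^ 2) (v ^ 2 * s ^ 2) (s ^ 2) _ _ _ (by rw [H.sin0]; ring)
    (by rw [H.sin1]; ring) (by rw [H.sin2]) rfl rfl rfl] at h1
  set A := 2 * Real.sin (p 0) * Real.cos (p 0) * V 0 with hA
  set B := 2 * Real.sin (p 1) * Real.cos (p 1) * V 1 with hB
  set C := 2 * Real.sin (p 2) * Real.cos (p 2) * V 2 with hC
  have hX : A - u ^ 2 * C = B - v ^ 2 * C := by linear_combination h3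
  have hX0 : A - u ^ 2 * C = 0 := by
    have hne : s ^ 6 * (w * (w + 2) ^ 3 * d * ((1 / 2 + 11 / 8 * w + 7 / 8 * w ^ 2 + w ^ 3 / 4) * t
        + w / 4 * r)) ≠ 0 := by
      have : (1 / 2 + 11 / 8 * w + 7 / 8 * w ^ 2 + w ^ 3 / 4) * t + w / 4 * r ≠ 0 := by positivity
      have : w * (w + 2) ^ 3 ≠ 0 := by positivity
      have : s ^ 6 ≠ 0 := by positivity
      simp_all
    refine (mul_eq_zero.1 ?_).resolve_left hne
    rw [← he]
    -- the remaining terms add up to a multiple of `eulerG`, which is homogeneous in the squares of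
    -- the sines
    have hA' : A = (A - u ^ 2 * C) + u ^ 2 * C := by ring
    have hB' : B = (A - u ^ 2 * C) + v ^ 2 * C := by rw [hX]; ring
    generalize A - u ^ 2 * C = X at hA' hB' ⊢
    rw [hA', hB'] at h1
    linear_combination h1 - 4 * s ^ 6 * C * hG0
  have hY0 : B - v ^ 2 * C = 0 := by rw [← hX, hX0]
  rw [hA, hC, H.sin0, H.sin2] at hX0
  rw [hB, hC, H.sin1, H.sin2] at hY0
  have e0 : Real.cos (p 0) * V 0 = u * Real.cos (p 2) * V 2 := by
    refine mul_left_cancel₀ (by positivity : 2 * u * s ≠ 0) ?_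
    linear_combination hX0
  have e1 : Real.cos (p 1) * V 1 = v * Real.cos (p 2) * V 2 := by
    refine mul_left_cancel₀ (by positivity : 2 * v * s ≠ 0) ?_
    linear_combination hY0
  rw [planeForm_apply] at h2
  have hz : V 2 = 0 := by
    refine (mul_eq_zero.1 (?_ : (Real.cos (p 0) * Real.cos (p 1) + (-Real.cos (p 2)) *
      (u * Real.cos (p 1) + v * Real.cos (p 0))) * V 2 = 0)).resolve_left ?_
    · linear_combination Real.cos (p 1) * e0 + Real.cos (p 0) * e1
        - Real.cos (p 0) * Real.cos (p 1) * h2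
    · have : 0 < -Real.cos (p 2) := by linarith
      positivity
  rw [hz, mul_zero, mul_eq_zero, or_iff_right c0.ne'] at e0
  rw [hz, mul_zero, mul_eq_zero, or_iff_right c1.ne'] at e1
  ext k
  fin_cases k <;> assumption

theorem CurveData.hasEREContinuation (H : CurveData p u v s w d) (hm : ∀ k, 0 < m k)
    (hU : p ∈ U) (hp : p ∈ eulerPlane) (hL : IsLagrangeShape m p) (M : MassData m u v d r t) :
    HasEREContinuation m p := by
  have hp' : p 2 = p 0 + p 1 := hp
  by_cases hd : d = 0
  · -- the isosceles shapes
    obtain ⟨h01, hm01⟩ := H.symmetric M hU hd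
    have hder : ∀ t, HasDerivAt (fun t : ℝ => (![p 0 + t, p 0 + t, 2 * (p 0 + t)] : Shape))
        ![1, 1, 2] t := by
      intro t
      have h1 : HasDerivAt (fun t : ℝ => p 0 + t) 1 t := (hasDerivAt_id t).const_add (p 0)
      rw [hasDerivAt_pi]
      intro k
      fin_cases k
      · exact h1
      · exact h1
      · simpa using h1.const_mul 2
    refine H.hasEREContinuation_of_arc hm hU (ε := 1)
      (γ := fun t => ![p 0 + t, p 0 + t, 2 * (p 0 + t)]) ⟨one_pos, ?_, ?_, fun t _ => ?_⟩
      fun t _ => ⟨?_, ?_⟩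
    · ext k
      fin_cases k
      · simp
      · simp [h01]
      · simp [hp', ← h01]
        ring
    · refine (contDiff_pi.2 fun k => ?_).contDiffOn
      fin_cases k
      · exact contDiff_const.add contDiff_id
      · exact contDiff_const.add contDiff_id
      · exact contDiff_const.mul (contDiff_const.add contDiff_id)
    · rw [(hder t).deriv]
      intro h0
      simpa using congrFun h0 0
    · simp [eulerPlane]
      ring
    · simp [eulerG, hm01]
      ring
  · obtain ⟨G', ℓ, hG', hinj⟩ := H.eulerG_derivative hm hL M hd
    obtain ⟨ε, γ, hγ, h, -⟩ := exists_regularArc (f₁ := planeForm) (p := p) ℓ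
      planeForm.contDiff.contDiffAt contDiff_eulerG.contDiffAt planeForm.hasFDerivAt hG'
      (by rw [planeForm_apply]; linarith) (H.eulerG_eq_zero hm hL).2
      fun V h1 h2 h3 => hinj V h2 h1 h3
    refine H.hasEREContinuation_of_arc hm hU hγ fun t ht => ⟨?_, (h t ht).2.1⟩
    have := (h t ht).1
    rw [planeForm_apply] at this
    change γ t 2 = γ t 0 + γ t 1
    linarith

end

/-! ### Bifurcation points -/

section
variable {m : Fin 3 → ℝ} {p : Shape} {u v s w d r t : ℝ}

/-- The masses of `MassData` with `r = R t`, in terms of the mass ratios. -/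
theorem CurveData.massData_of_ratios (H : CurveData p u v s w d) (hm : ∀ k, 0 < m k) {R : ℝ}
    (hR : 0 < R) (h0 : m 0 / m 2 = (R + d / 2) / (u ^ 2 * (1 + v ^ 2 + u ^ 2 * v ^ 2)))
    (h1 : m 1 / m 2 = (R - d / 2) / (v ^ 2 * (1 + u ^ 2 + u ^ 2 * v ^ 2))) :
    ∃ t, MassData m u v d (R * t) t := by
  have hu := H.u_pos
  have hv := H.v_pos
  have h2 := hm 2
  rw [div_eq_iff h2.ne'] at h0 h1
  refine ⟨m 2 / (u ^ 2 * v ^ 2 * (1 + v ^ 2 + u ^ 2 * v ^ 2) * (1 + u ^ 2 + u ^ 2 * v ^ 2)),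
    by positivity, by positivity, ?_, ?_, ?_⟩
  · rw [h0]
    field_simp
  · rw [h1]
    field_simp
  · field_simp

theorem CurveData.isLagrangeShape_of_massData (H : CurveData p u v s w d) (hm : ∀ k, 0 < m k)
    (M : MassData m u v d r t) : IsLagrangeShape m p := by
  rw [H.isLagrangeShape_iff hm, M.m0, M.m1, M.m2]
  ring

theorem isBifurcationPoint_of_reaches (hm : ∀ k, 0 < m k) (hU : p ∈ U) (hp : p ∈ eulerPlane)
    (h : LREContinuationReaches m p) : CurvedThreeBody.h p = 0 ∧ IsBifurcationPoint m p := by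
  obtain ⟨hx, hL⟩ := h.isLagrangeShape hm hU hp
  have hq : Real.sin (p 0) ^ 4 + Real.sin (p 1) ^ 4 = Real.sin (p 2) ^ 4 := sub_eq_zero.1 hx
  obtain ⟨u, v, s, w, d, H⟩ := exists_curveData hU hp hq
  obtain ⟨r, t, M⟩ := H.exists_massData hm hL
  refine ⟨(h_eq_zero_iff hU hp).2 hq, ⟨hU, hp⟩, H.hasEREContinuation hm hU hp hL M, ?_⟩
  by_cases hT : tangency w r t = 0
  · by_cases hd : d = 0
    · exact H.hasLRECoupling_of_isosceles hm hU hp hL M hd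
    · exact H.hasLRECoupling_of_reaches hm hU hp hL M hT hd h
  · exact H.hasLRECoupling_of_tangency_ne_zero hm hU hp hL M hT

/-- For a third mass that is not too large, the Lagrange shapes cross the plane at `p`. -/
theorem CurveData.isBifurcationPoint_of_ratios (H : CurveData p u v s w d) (hm : ∀ k, 0 < m k)
    (hU : p ∈ U) (hp : p ∈ eulerPlane) {R : ℝ} (hR : 2 ≤ R)
    (h0 : m 0 / m 2 = (R + d / 2) / (u ^ 2 * (1 + v ^ 2 + u ^ 2 * v ^ 2)))
    (h1 : m 1 / m 2 = (R - d / 2) / (v ^ 2 * (1 + u ^ 2 + u ^ 2 * v ^ 2))) :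
    IsBifurcationPoint m p := by
  obtain ⟨t, M⟩ := H.massData_of_ratios hm (by linarith) h0 h1
  have hL := H.isLagrangeShape_of_massData hm M
  have ht := M.t_pos
  exact ⟨⟨hU, hp⟩, H.hasEREContinuation hm hU hp hL M,
    H.hasLRECoupling_of_tangency_ne_zero hm hU hp hL M
      (tangency_pos H.w_pos H.bounds.1 ht (by gcongr)).ne'⟩

end

/-- The segment consists of the mass ratios with `2 ≤ r / t ≤ 3`. -/
theorem exists_segment {p : Shape} (hU : p ∈ U) (hp : p ∈ eulerPlane) (h : h p = 0) :
    ∃ a b : ℝ × ℝ, a ≠ b ∧ ∀ ν ∈ segment ℝ a b, 0 < ν.1 ∧ 0 < ν.2 ∧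
      ∀ m : Fin 3 → ℝ, (∀ k, 0 < m k) → m 0 / m 2 = ν.1 → m 1 / m 2 = ν.2 →
        IsBifurcationPoint m p := by
  obtain ⟨u, v, s, w, d, H⟩ := exists_curveData hU hp ((h_eq_zero_iff hU hp).1 h)
  have hu := H.u_pos
  have hv := H.v_pos
  obtain ⟨-, hd1, hd2⟩ := H.bounds
  let ratios : ℝ → ℝ × ℝ := fun R => ((R + d / 2) / (u ^ 2 * (1 + v ^ 2 + u ^ 2 * v ^ 2)),
    (R - d / 2) / (v ^ 2 * (1 + u ^ 2 + u ^ 2 * v ^ 2)))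
  refine ⟨ratios 2, ratios 3, fun h0 => ?_, ?_⟩
  · have h1 : (ratios 2).1 = (ratios 3).1 := by rw [h0]
    simp only [ratios] at h1
    rw [div_left_inj' (by positivity)] at h1
    linarith
  · rintro ν ⟨x, y, hx, hy, hxy, rfl⟩
    have hR : 2 ≤ 2 * x + 3 * y := by linarith
    have e : x • ratios 2 + y • ratios 3 = ratios (2 * x + 3 * y) := by
      have hx' : x = 1 - y := by linarith
      subst hx'
      ext
      · simp [ratios]
        ring
      · simp [ratios]
        ring
    rw [e]
    have r1 : 0 < 2 * x + 3 * y + d / 2 := by linarith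
    have r2 : 0 < 2 * x + 3 * y - d / 2 := by linarith
    refine ⟨by simp only [ratios]; positivity, by simp only [ratios]; positivity,
      fun m hm h0 h1 => H.isBifurcationPoint_of_ratios hm hU hp hR h0 h1⟩

end CurvedThreeBody

end

theorem mainTheorem1 :
    (∀ p ∈ CurvedThreeBody.U ∩ CurvedThreeBody.eulerPlane, CurvedThreeBody.h p = 0 →
      ∃ u v : ℝ × ℝ, u ≠ v ∧ ∀ ν ∈ segment ℝ u v, 0 < ν.1 ∧ 0 < ν.2 ∧
        ∀ m : Fin 3 → ℝ, (∀ k, 0 < m k) → m 0 / m 2 = ν.1 → m 1 / m 2 = ν.2 →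
          CurvedThreeBody.IsBifurcationPoint m p) ∧
    (∀ m : Fin 3 → ℝ, (∀ k, 0 < m k) →
      ∀ p ∈ CurvedThreeBody.U ∩ CurvedThreeBody.eulerPlane,
        CurvedThreeBody.LREContinuationReaches m p →
          CurvedThreeBody.h p = 0 ∧ CurvedThreeBody.IsBifurcationPoint m p) :=
  ⟨fun _ hp h => CurvedThreeBody.exists_segment hp.1 hp.2 h,
    fun _ hm _ hp h => CurvedThreeBody.isBifurcationPoint_of_reaches hm hp.1 hp.2 h⟩
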